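/- Let $q$ be a power of $2$ and $n>1$. A parabolic quasi-quadric in $\mathrm{PG}(2n,q)$ is a set $\mathcal S$ of points such that every hyperplane meets $\mathcal S$ in $|\mathcal Q^+(2n-1,q)|$, $|\mathcal Q^-(2n-1,q)|$ or $|P\mathcal Q(2n-2,q)|$ points, where $\mathcal Q^+(2n-1,q)$, $\mathcal Q^-(2n-1,q)$, $\mathcal Q(2n-2,q)$ are the non-singular hyperbolic, elliptic and parabolic quadrics and $P\mathcal C$ denotes the cone with vertex a point $P$ and base $\mathcal C$ in a subspace not containing $P$. A nucleus of a point set $\mathcal S$ of a projective space is a point $N\notin\mathcal S$ of that space such that every line of the space through $N$ contains exactly one point of $\mathcal S$. (1) There is a parabolic quasi-quadric in $\mathrm{PG}(2n,q)$ with $|\mathcal Q(2n,q)|$ points that has no nucleus. (2) Let $\mathcal Q=\mathcal Q(2n,q)$ be a non-singular parabolic quadric in $\mathrm{PG}(2n,q)$ with nucleus $N$, let $\pi$ be a singular hyperplane of $\mathcal Q$, meeting $\mathcal Q$ in the cone $P\mathcal C$ with vertex a point $P$ and base the non-singular parabolic quadric $\mathcal C=\mathcal Q\cap\mu$, where $\mu$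 is a hyperplane of $\pi$ with $P\notin\mu$ and $N\in\mu$. Let $\mathcal C'$ be a non-singular parabolic quadric in $\mu$ with nucleus $N'\neq N$. Then the set $\mathcal Q'=(\mathcal Q\setminus P\mathcal C)\cup P\mathcal C'$, obtained by pivoting, is a parabolic quasi-quadric with $|\mathcal Q(2n,q)|$ points that has no nucleus. (3) Every non-singular parabolic quadric $\mathcal Q$ in $\mathrm{PG}(2n,q)$ has a nucleus $N$ and admits data $\pi,P,\mu,\mathcal C',N'$ as in (2). -/

import Mathlib

open scoped LinearAlgebra.Projectivization

/-- The projective space `PG(m, q)` over the field `K` with `q` elements. -/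
abbrev PG (m : ℕ) (K : Type*) [Field K] : Type _ := ℙ K (Fin (m + 1) → K)

section QuasiQuadrics

variable {K : Type*} [Field K]

/-! ### The standard quadratic forms -/

/-- The hyperbolic form `x₁y₁ + ⋯ + x_k y_k` in `2k` variables. -/
def hyperbolicForm (K : Type*) [Field K] (k : ℕ) : QuadraticForm K (Fin k → K × K) :=
  QuadraticMap.pi fun _ =>
    QuadraticMap.linMulLin (LinearMap.fst K K K) (LinearMap.snd K K K)

/-- The parabolic form `x₀² + x₁y₁ + ⋯ + x_k y_k` in `2k + 1` variables. -/
def parabolicForm (K : Type*) [Field K] (k : ℕ) :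
    QuadraticForm K (K × (Fin k → K × K)) :=
  (QuadraticMap.sq (R := K)).prod (hyperbolicForm K k)

/-- The elliptic form `g(x₀, y₀) + x₁y₁ + ⋯ + x_k y_k` in `2k + 2` variables; here `g` is a binary
form, which is required to be anisotropic (that is, irreducible) where this form is used. -/
def ellipticForm (g : QuadraticForm K (K × K)) (k : ℕ) :
    QuadraticForm K ((K × K) × (Fin k → K × K)) :=
  g.prod (hyperbolicForm K k)

variable {V : Type*} [AddCommGroup V] [Module K V]

/-! ### Points, subspaces and quadrics

A projective subspace of `PG(V)` is represented by the linear subspace `W` of `V` underlying it;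
its projective dimension is `finrank K W - 1`. -/

/-- The set of points of the projective subspace given by `W`. -/
def pointsOf (W : Submodule K V) : Set (ℙ K V) := {p | p.submodule ≤ W}

/-- A hyperplane of the projective subspace given by `W`. -/
def IsHyperplaneOf (H W : Submodule K V) : Prop :=
  H ≤ W ∧ Module.finrank K H + 1 = Module.finrank K W

/-- The points of `W` on which the quadratic form `f` on `W` vanishes. -/
def quadricOf (W : Submodule K V) (f : QuadraticForm K W) : Set (ℙ K V) :=
  {p | p ∈ pointsOf W ∧ ∀ w : W, (w : V) ∈ p.submodule → f w = 0}

/-- `T` is a hyperbolic quadric `Q⁺(2k-1, q)` of `W`, where `2k = dim W`. -/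
def IsHyperbolicQuadric (W : Submodule K V) (T : Set (ℙ K V)) : Prop :=
  ∃ (k : ℕ) (f : QuadraticForm K W), f.Equivalent (hyperbolicForm K k) ∧ T = quadricOf W f

/-- `T` is an elliptic quadric `Q⁻(2k+1, q)` of `W`, where `2k + 2 = dim W`. -/
def IsEllipticQuadric (W : Submodule K V) (T : Set (ℙ K V)) : Prop :=
  ∃ (k : ℕ) (g : QuadraticForm K (K × K)) (f : QuadraticForm K W),
    g.Anisotropic ∧ f.Equivalent (ellipticForm g k) ∧ T = quadricOf W f

/-- `T` is a (non-singular) parabolic quadric `Q(2k, q)` of `W`, where `2k + 1 = dim W`. -/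
def IsParabolicQuadric (W : Submodule K V) (T : Set (ℙ K V)) : Prop :=
  ∃ (k : ℕ) (f : QuadraticForm K W), f.Equivalent (parabolicForm K k) ∧ T = quadricOf W f

/-- The cone with vertex the point `P` and base `C`: the point `P` together with the points of the
lines joining `P` to the points of `C`. -/
def cone (P : ℙ K V) (C : Set (ℙ K V)) : Set (ℙ K V) :=
  {P} ∪ {R | ∃ X ∈ C, R.submodule ≤ P.submodule ⊔ X.submodule}

/-- `T` is a cone `P Q(2k, q)` spanning `W`: the vertex is a point `P` of `W` and the base is a
parabolic quadric of a hyperplane of `W` not through `P`. -/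
def IsParabolicCone (W : Submodule K V) (T : Set (ℙ K V)) : Prop :=
  ∃ (P : ℙ K V) (U : Submodule K V) (C : Set (ℙ K V)),
    P ∈ pointsOf W ∧ IsHyperplaneOf U W ∧ P ∉ pointsOf U ∧ IsParabolicQuadric U C ∧ T = cone P C

/-- A parabolic quasi-quadric (the vector space `V` has odd dimension `2n + 1`): every hyperplane
meets `S` in `|Q⁺(2n-1, q)|`, `|Q⁻(2n-1, q)|` or `|P Q(2n-2, q)|` points. -/
def IsParabolicQuasiQuadric (S : Set (ℙ K V)) : Prop :=
  ∀ H : Submodule K V, IsHyperplaneOf H ⊤ →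
    ∃ T : Set (ℙ K V),
      (IsHyperbolicQuadric H T ∨ IsEllipticQuadric H T ∨ IsParabolicCone H T) ∧
        (S ∩ pointsOf H).ncard = T.ncard

/-- `N` is a nucleus of the point set `S` in the projective space given by `W`: a point of `W` not
in `S` such that every line of `W` through `N` contains exactly one point of `S`. -/
def IsNucleus (W : Submodule K V) (S : Set (ℙ K V)) (N : ℙ K V) : Prop :=
  N ∈ pointsOf W ∧ N ∉ S ∧
    ∀ L : Submodule K V, L ≤ W → Module.finrank K L = 2 → N ∈ pointsOf L →
      ∃! X : ℙ K V, X ∈ S ∧ X ∈ pointsOf L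

/-! ### Pivoting -/

/-- The hyperplane `π` is a singular hyperplane of `Q`, meeting `Q` in the cone `P C` with vertex
`P` and base the parabolic quadric `C = Q ∩ μ` of the hyperplane `μ` of `π`. -/
def MeetsInCone (Q : Set (ℙ K V)) (π μ : Submodule K V) (P : ℙ K V) : Prop :=
  IsHyperplaneOf π ⊤ ∧ IsHyperplaneOf μ π ∧ P ∈ pointsOf π ∧ P ∉ pointsOf μ ∧
    IsParabolicQuadric μ (Q ∩ pointsOf μ) ∧ Q ∩ pointsOf π = cone P (Q ∩ pointsOf μ)

/-- The set obtained from `Q` by replacing the points of `Q` in the hyperplane `π` by the cone with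
vertex `P` and base `C'`. -/
def pivot (Q : Set (ℙ K V)) (π : Submodule K V) (P : ℙ K V) (C' : Set (ℙ K V)) :
    Set (ℙ K V) :=
  (Q \ (Q ∩ pointsOf π)) ∪ cone P C'

end QuasiQuadrics

/-! ### Sizes of the level sets of quadratic forms in characteristic two. -/

section LevelCounts

variable {K : Type*} [Field K]

/-! Counting is done with vectors instead of points. A parabolic cone, a hyperbolic quadric and an
elliptic quadric of a hyperplane H of vector dimension 2k have z vectors with q z = q^(2k) + ε q^k
(q - 1), for ε = 0, 1, -1 respectively. All three exist in every H, so a set is a parabolic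
quasi-quadric once its hyperplane sections have such counts
(`isParabolicQuasiQuadric_of_ncard_vectorsOf`). A parabolic quadric has them: a hyperplane through
the nucleus gives ε = 0, and on any other the form is an orthogonal sum of binary forms, whose signs
multiply (`exists_ncard_parabolicForm_inter_ker`).

Pivoting keeps this property (`isParabolicQuasiQuadric_pivot`). A hyperplane H missing P meets the
old and the new cone equally often, by projection from P. If H = π, only the cone over C' remains,
and ε = 0. If H contains P and differs from π, then outside π every line of H through P carries
exactly one further point of the quadric, a contribution depending only on q and n; inside π one
sees the cone over C' ∩ H, so H inherits the sign of the section of C'.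

The pivoted set has no nucleus (`not_isNucleus_pivot`). A point off π is joined to P by a line with
two points of the set. A nucleus in π sees the old quadric along all lines leaving π; this forces it
to be P, which lies in the set, or N. But if N were a nucleus, it would be one of C' inside μ,
against N' ≠ N. A suitable C' exists because every point of μ is the nucleus of some parabolic
quadric (`exists_isParabolicQuadric_isNucleus`). -/

open Classical in
/-- The level sets of `F` have the sizes of those of a non-degenerate quadratic form in `2d`
variables, hyperbolic for `ε = 1` and elliptic for `ε = -1`. -/
def HasLevelCounts {A : Type*} (F : A → K) (d : ℕ) (ε : ℤ) : Prop :=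
  ∀ c : K, (Nat.card K : ℤ) * {v | F v = c}.ncard =
    Nat.card K ^ (2 * d) + ε * Nat.card K ^ d * (if c = 0 then (Nat.card K : ℤ) - 1 else -1)

theorem ncard_add_eq_sum [Fintype K] {A B : Type*} [Finite A] [Finite B] (F : A → K) (G : B → K)
    (c : K) : {p : A × B | F p.1 + G p.2 = c}.ncard =
      ∑ a : K, {v | F v = a}.ncard * {v | G v = c - a}.ncard := by
  classical
  have := Fintype.ofFinite A
  have := Fintype.ofFinite B
  rw [Set.ncard_eq_toFinset_card', Finset.card_eq_sum_card_fiberwise (f := fun p => F p.1)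
    (t := Finset.univ) (fun _ _ => Finset.mem_coe.2 (Finset.mem_univ _))]
  refine Finset.sum_congr rfl fun a _ => ?_
  rw [Set.ncard_eq_toFinset_card', Set.ncard_eq_toFinset_card', ← Finset.card_product]
  congr 1
  ext ⟨x, y⟩
  simp only [Finset.mem_filter, Set.mem_toFinset, Set.mem_ofPred_eq, Finset.mem_product]
  constructor
  · rintro ⟨h, rfl⟩
    exact ⟨rfl, by rw [← h]; ring⟩
  · rintro ⟨rfl, h⟩
    exact ⟨by rw [h]; ring, rfl⟩

/-- The level counts of F + G are the convolution of those of F and G. Each is a constant plus ε q^d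
times the indicator of 0, a shape stable under convolution, with the signs multiplying. -/
theorem HasLevelCounts.prod [Finite K] {A B : Type*} [Finite A] [Finite B] {F : A → K} {G : B → K}
    {d d' : ℕ} {ε ε' : ℤ} (hF : HasLevelCounts F d ε) (hG : HasLevelCounts G d' ε') :
    HasLevelCounts (fun p : A × B => F p.1 + G p.2) (d + d') (ε * ε') := by
  classical
  intro c
  have := Fintype.ofFinite K
  rw [ncard_add_eq_sum]
  unfold HasLevelCounts at hF hG
  have hq : (Nat.card K : ℤ) ≠ 0 := by exact_mod_cast Nat.card_pos.ne'
  have hcard : ∑ _a : K, (1 : ℤ) = Nat.card K := by simp [Nat.card_eq_fintype_card]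
  -- A second factor q lets each of the two counts absorb one.
  apply mul_left_cancel₀ hq
  push_cast
  rw [Finset.mul_sum, Finset.mul_sum]
  set q : ℤ := (Nat.card K : ℤ)
  clear_value q
  have key : ∀ a : K, q * (q * (({v | F v = a}.ncard : ℤ) * {v | G v = c - a}.ncard)) =
      (q ^ (2 * d) - ε * q ^ d) * (q ^ (2 * d') - ε' * q ^ d') * 1
      + (if a = 0 then q * (ε * q ^ d) * (q ^ (2 * d') - ε' * q ^ d')
          + (if c = 0 then q ^ 2 * (ε * q ^ d) * (ε' * q ^ d') else 0) else 0)
      + (if a = c then q * (ε' * q ^ d') * (q ^ (2 * d) - ε * q ^ d) else 0) := by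
    intro a
    have h1 := hF a
    have h2 := hG (c - a)
    rw [show q * (q * (({v | F v = a}.ncard : ℤ) * {v | G v = c - a}.ncard)) =
      (q * {v | F v = a}.ncard) * (q * {v | G v = c - a}.ncard) by ring, h1, h2]
    by_cases ha : a = 0
    · subst ha
      by_cases hc : c = 0
      · subst hc; simp; ring
      · simp [hc, Ne.symm hc]; ring
    · by_cases hac : a = c
      · subst hac; simp [ha]; ring
      · simp [ha, hac, sub_eq_zero, Ne.symm hac]; ring
  have hs : ∑ a : K, q * (q * (({v | F v = a}.ncard : ℤ) * {v | G v = c - a}.ncard)) =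
      (q ^ (2 * d) - ε * q ^ d) * (q ^ (2 * d') - ε' * q ^ d') * q
      + (q * (ε * q ^ d) * (q ^ (2 * d') - ε' * q ^ d')
          + (if c = 0 then q ^ 2 * (ε * q ^ d) * (ε' * q ^ d') else 0))
      + q * (ε' * q ^ d') * (q ^ (2 * d) - ε * q ^ d) := by
    rw [Finset.sum_congr rfl fun a _ => key a, Finset.sum_add_distrib, Finset.sum_add_distrib,
      ← Finset.mul_sum, hcard, Finset.sum_ite_eq' , Finset.sum_ite_eq']
    simp
  rw [← Finset.mul_sum] at hs ⊢
  rw [hs]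
  split_ifs <;> ring

theorem HasLevelCounts.comp_equiv {A B : Type*} {F : A → K} {d : ℕ} {ε : ℤ}
    (h : HasLevelCounts F d ε) (e : B ≃ A) : HasLevelCounts (fun b => F (e b)) d ε := by
  intro c
  rw [← h c]
  congr 2
  exact Set.ncard_congr' (Equiv.subtypeEquiv e fun _ => Iff.rfl)

theorem hasLevelCounts_zero [Finite K] {A : Type*} [Unique A] (F : A → K) (hF : ∀ a, F a = 0) :
    HasLevelCounts F 0 1 := by
  intro c
  by_cases hc : c = 0
  · subst hc; simp [hF, Set.ncard_univ]
  · have : {v | F v = c} = ∅ := by ext v; simp [hF, Ne.symm hc]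
    simp [this, hc]

theorem HasLevelCounts.pi [Finite K] {A : Type*} [Finite A] :
    ∀ (k : ℕ) (F : Fin k → A → K) (ε : Fin k → ℤ), (∀ i, HasLevelCounts (F i) 1 (ε i)) →
      HasLevelCounts (fun z : Fin k → A => ∑ i, F i (z i)) k (∏ i, ε i)
  | 0, F, ε, _ => by simpa using hasLevelCounts_zero (fun z : Fin 0 → A => ∑ i, F i (z i)) (by simp)
  | k + 1, F, ε, h => by
    have h1 := ((h 0).prod (HasLevelCounts.pi k (fun i => F i.succ) (fun i => ε i.succ)
      fun i => h i.succ)).comp_equiv (Fin.consEquiv fun _ => A).symm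
    rw [Fin.prod_univ_succ]
    simp only [Fin.sum_univ_succ]
    rw [add_comm 1 k] at h1
    exact h1

theorem exists_sq_eq [Finite K] [CharP K 2] (a : K) : ∃ t : K, t ^ 2 = a := by
  obtain ⟨t, rfl⟩ := FiniteField.isSquare_of_char_two (ringChar.eq K 2 ▸ rfl) a
  exact ⟨t, sq t⟩

/-- For a homogeneous function of degree two over a finite field of characteristic two, all
level sets but the zero set have the same size. -/
theorem hasLevelCounts_of_ncard_zeros [Finite K] [CharP K 2] {M : Type*} [AddCommGroup M]
    [Module K M] [Finite M] (F : M → K) (hF : ∀ (t : K) v, F (t • v) = t ^ 2 * F v) {d : ℕ} {ε : ℤ}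
    (hM : Nat.card M = Nat.card K ^ (2 * d))
    (h0 : (Nat.card K : ℤ) * {v | F v = 0}.ncard =
      Nat.card K ^ (2 * d) + ε * Nat.card K ^ d * (Nat.card K - 1)) :
    HasLevelCounts F d ε := by
  classical
  -- Multiplication by a square root of c carries the level set of 1 onto that of c.
  have hlev : ∀ c : K, c ≠ 0 → {v | F v = c}.ncard = {v | F v = 1}.ncard := by
    intro c hc
    obtain ⟨t, rfl⟩ := exists_sq_eq c
    have ht : t ≠ 0 := by rintro rfl; simp at hc
    refine (Set.ncard_congr (fun v _ => t • v) (fun v hv => ?_) (fun v w _ _ h => ?_)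
      (fun v hv => ?_)).symm
    · simp only [Set.mem_ofPred_eq] at hv ⊢
      rw [hF, hv, mul_one]
    · exact smul_right_injective M ht h
    · refine ⟨t⁻¹ • v, ?_, by simp [smul_smul, ht]⟩
      simp only [Set.mem_ofPred_eq] at hv ⊢
      rw [hF, hv]; field_simp
  have := Fintype.ofFinite K
  have := Fintype.ofFinite M
  have hsum : Nat.card M = ∑ c : K, {v | F v = c}.ncard := by
    rw [Nat.card_eq_fintype_card, ← Finset.card_univ,
      Finset.card_eq_sum_card_fiberwise (f := F) (t := Finset.univ)
        (fun _ _ => Finset.mem_coe.2 (Finset.mem_univ _))]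
    refine Finset.sum_congr rfl fun c _ => ?_
    rw [Set.ncard_eq_toFinset_card']
    congr 1; ext; simp
  rw [← Finset.add_sum_erase _ _ (Finset.mem_univ (0 : K)),
    Finset.sum_congr rfl (fun c hc => hlev c (Finset.ne_of_mem_erase hc)), Finset.sum_const,
    Finset.card_erase_of_mem (Finset.mem_univ _), Finset.card_univ, ← Nat.card_eq_fintype_card,
    smul_eq_mul, hM] at hsum
  have hq1 : 1 < Nat.card K := Finite.one_lt_card
  zify [hq1.le] at hsum
  intro c
  by_cases hc : c = 0
  · subst hc; simpa using h0
  · rw [hlev c hc, if_neg hc]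
    have : (Nat.card K : ℤ) - 1 ≠ 0 := by
      have : (1 : ℤ) < Nat.card K := by exact_mod_cast hq1
      linarith
    apply mul_left_cancel₀ this
    linear_combination (-(Nat.card K : ℤ)) * hsum - h0

omit [Field K] in
theorem card_prod_self : Nat.card (K × K) = Nat.card K ^ (2 * 1) := by
  rw [Nat.card_prod]; ring

theorem ncard_line_union_line [Finite K] {u w : K × K} (hu : u ≠ 0) (hw : ∀ t : K, w ≠ t • u) :
    (Set.range (fun t : K => t • u) ∪ Set.range (fun t : K => t • w)).ncard + 1 =
      2 * Nat.card K := by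
  have hw0 : w ≠ 0 := by simpa using hw 0
  have hcard : ∀ v : K × K, v ≠ 0 → (Set.range (fun t : K => t • v)).ncard = Nat.card K := by
    intro v hv
    rw [← Set.image_univ, Set.ncard_image_of_injective _ (smul_left_injective K hv),
      Set.ncard_univ]
  have hinter : Set.range (fun t : K => t • u) ∩ Set.range (fun t : K => t • w) = {0} := by
    ext v
    simp only [Set.mem_inter_iff, Set.mem_range, Set.mem_singleton_iff]
    constructor
    · rintro ⟨⟨s, rfl⟩, ⟨t, ht⟩⟩
      by_cases h : t = 0
      · rw [← ht, h, zero_smul]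
      · refine absurd ?_ (hw (t⁻¹ * s))
        rw [mul_smul, ← ht, smul_smul, inv_mul_cancel₀ h, one_smul]
    · rintro rfl
      exact ⟨⟨0, zero_smul _ _⟩, ⟨0, zero_smul _ _⟩⟩
  have := Set.ncard_union_add_ncard_inter (Set.range fun t : K => t • u)
    (Set.range fun t : K => t • w)
  rw [hinter, Set.ncard_singleton, hcard u hu, hcard w hw0] at this
  omega

/-- A binary quadratic form with non-degenerate polar form is hyperbolic or elliptic. -/
theorem exists_hasLevelCounts_binary [Finite K] [CharP K 2] (b c : K) :
    ∃ ε : ℤ, (ε = 1 ∨ ε = -1) ∧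
      HasLevelCounts (fun z : K × K => (b * z.1 + c * z.2) ^ 2 + z.1 * z.2) 1 ε := by
  have h2 : (2 : K) = 0 := CharTwo.two_eq_zero
  have hom : ∀ (t : K) (v : K × K), (b * (t • v).1 + c * (t • v).2) ^ 2 + (t • v).1 * (t • v).2 =
      t ^ 2 * ((b * v.1 + c * v.2) ^ 2 + v.1 * v.2) := by
    intro t v
    simp only [Prod.smul_fst, Prod.smul_snd, smul_eq_mul]; ring
  -- Two lines through 0 have 2q - 1 vectors, which is the count for ε = 1; the zero vector alone is
  -- the count for ε = -1.
  have hlines : ∀ u w : K × K, u ≠ 0 → (∀ t : K, w ≠ t • u) →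
      {z : K × K | (b * z.1 + c * z.2) ^ 2 + z.1 * z.2 = 0} =
        Set.range (fun t : K => t • u) ∪ Set.range (fun t : K => t • w) →
      HasLevelCounts (fun z : K × K => (b * z.1 + c * z.2) ^ 2 + z.1 * z.2) 1 1 := by
    intro u w hu hw h
    refine hasLevelCounts_of_ncard_zeros _ hom card_prod_self ?_
    have := ncard_line_union_line hu hw
    rw [← h] at this
    zify at this
    rw [eq_sub_of_add_eq this]; ring
  by_cases hb : b = 0
  · refine ⟨1, Or.inl rfl, hlines (1, 0) (c ^ 2, 1) (by simp) (by simp) ?_⟩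
    ext ⟨x, y⟩
    simp only [hb, Set.mem_ofPred_eq, Set.mem_union, Set.mem_range, Prod.smul_mk, smul_eq_mul,
      mul_one, mul_zero, Prod.mk.injEq]
    rw [show (0 * x + c * y) ^ 2 + x * y = y * (y * c ^ 2 + x) by ring, mul_eq_zero]
    refine or_congr ⟨fun h => ⟨x, rfl, h.symm⟩, fun ⟨_, _, h⟩ => h.symm⟩
      ⟨fun h => ⟨y, CharTwo.add_eq_zero.1 h, rfl⟩, ?_⟩
    rintro ⟨t, rfl, rfl⟩
    exact CharTwo.add_self_eq_zero _
  -- With y = 1 the form is b²t² + t + c². Two roots sum to 1 / b², so one root t yields the other,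
  -- t + 1 / b². Without roots only the zero vector is singular, as b ≠ 0.
  by_cases ht : ∃ t : K, (b * t + c) ^ 2 + t = 0
  · obtain ⟨t, ht⟩ := ht
    refine ⟨1, Or.inl rfl, hlines (t, 1) (t + (b ^ 2)⁻¹, 1) (by simp) ?_ ?_⟩
    · rintro s h
      simp only [Prod.smul_mk, smul_eq_mul, mul_one, Prod.mk.injEq] at h
      rw [← h.2, one_mul, add_eq_left] at h
      exact hb (by simpa using h.1)
    · ext ⟨x, y⟩
      simp only [Set.mem_ofPred_eq, Set.mem_union, Set.mem_range, Prod.smul_mk, smul_eq_mul,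
        mul_one, Prod.mk.injEq]
      have hfac : (b * x + c * y) ^ 2 + x * y =
          b ^ 2 * ((y * t + x) * (y * (t + (b ^ 2)⁻¹) + x)) := by
        field_simp
        linear_combination y ^ 2 * ht + (b * c * x * y - b * c * t * y ^ 2 -
          b ^ 2 * t ^ 2 * y ^ 2 - t * y ^ 2 - b ^ 2 * t * x * y) * h2
      rw [hfac, mul_eq_zero, or_iff_right (pow_ne_zero 2 hb), mul_eq_zero, CharTwo.add_eq_zero,
        CharTwo.add_eq_zero]
      refine or_congr ⟨fun h => ⟨y, h, rfl⟩, ?_⟩ ⟨fun h => ⟨y, h, rfl⟩, ?_⟩ <;>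
      · rintro ⟨s, h, rfl⟩
        exact h
  · refine ⟨-1, Or.inr rfl, hasLevelCounts_of_ncard_zeros _ hom card_prod_self ?_⟩
    have : {z : K × K | (b * z.1 + c * z.2) ^ 2 + z.1 * z.2 = 0} = {0} := by
      ext ⟨x, y⟩
      simp only [Set.mem_ofPred_eq, Set.mem_singleton_iff, Prod.mk_eq_zero]
      refine ⟨fun h => ?_, fun ⟨hx, hy⟩ => by rw [hx, hy]; ring⟩
      by_cases hy : y = 0
      · subst hy
        have : b * x = 0 := by simpa using h
        exact ⟨(mul_eq_zero.1 this).resolve_left hb, rfl⟩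
      · refine absurd ⟨x / y, ?_⟩ ht
        field_simp
        linear_combination h
    rw [this, Set.ncard_singleton]
    push_cast; ring

theorem hasLevelCounts_anisotropic [Finite K] [CharP K 2] (g : QuadraticForm K (K × K))
    (hg : g.Anisotropic) : HasLevelCounts g 1 (-1) := by
  refine hasLevelCounts_of_ncard_zeros _ (fun t v => ?_) card_prod_self ?_
  · rw [QuadraticMap.map_smul, smul_eq_mul, sq]
  · have : {v | g v = 0} = {0} := by
      ext v
      simp only [Set.mem_ofPred_eq, Set.mem_singleton_iff]
      exact QuadraticMap.Anisotropic.eq_zero_iff hg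
    rw [this, Set.ncard_singleton]
    push_cast; ring

/-- The map t ↦ t² + t identifies 0 and 1, so it misses some δ; then x² + xy + δy² has no nontrivial
zero. -/
theorem exists_anisotropic [Finite K] [CharP K 2] :
    ∃ g : QuadraticForm K (K × K), g.Anisotropic := by
  have hns : ¬ Function.Surjective (fun t : K => t ^ 2 + t) := by
    intro h
    have := (Finite.injective_iff_surjective.2 h) (a₁ := 0) (a₂ := 1)
      (by simp [CharTwo.add_self_eq_zero])
    exact zero_ne_one this
  simp only [Function.Surjective, not_forall, not_exists] at hns
  obtain ⟨δ, hδ⟩ := hns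
  refine ⟨QuadraticMap.linMulLin (LinearMap.fst K K K) (LinearMap.fst K K K + LinearMap.snd K K K)
    + δ • QuadraticMap.linMulLin (LinearMap.snd K K K) (LinearMap.snd K K K), ?_⟩
  rintro ⟨x, y⟩ h
  simp only [add_apply, smul_apply, QuadraticMap.linMulLin_apply,
    LinearMap.add_apply, LinearMap.fst_apply, LinearMap.snd_apply, smul_eq_mul] at h
  by_cases hy : y = 0
  · subst hy; simpa using h
  · refine absurd ?_ (hδ (x / y))
    rw [← sub_eq_zero, CharTwo.sub_eq_add]
    field_simp
    linear_combination h

end LevelCounts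

/-! ### Zeros of the standard forms, and of parabolic forms on hyperplanes. -/

section ParabolicForms

variable {K : Type*} [Field K]

/-- If each line of direction `p` in `A` meets `A₀` exactly once, then `|A| = q |A₀|`. -/
theorem ncard_eq_mul_of_existsUnique_translate [Finite K] {M : Type*} [AddCommGroup M] [Module K M]
    [Finite M] (p : M) {A A₀ : Set M} (hsub : A₀ ⊆ A) (hA : ∀ v ∈ A, ∀ t : K, v + t • p ∈ A)
    (h : ∀ v ∈ A, ∃! t : K, v + t • p ∈ A₀) : A.ncard = Nat.card K * A₀.ncard := by
  have himg : A = (fun x : M × K => x.1 + x.2 • p) '' (A₀ ×ˢ Set.univ) := by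
    ext v
    simp only [Set.mem_image, Set.mem_prod, Set.mem_univ, and_true, Prod.exists]
    constructor
    · intro hv
      obtain ⟨t, ht, -⟩ := h v hv
      exact ⟨v + t • p, -t, ht, by simp⟩
    · rintro ⟨w, t, hw, rfl⟩
      exact hA w (hsub hw) t
  rw [himg, Set.InjOn.ncard_image, Set.ncard_prod, Set.ncard_univ, mul_comm]
  rintro ⟨v, s⟩ ⟨hv, -⟩ ⟨w, t⟩ ⟨hw, -⟩ hvw
  have hw' : w = v + (s - t) • p := by
    have : v + s • p = w + t • p := hvw
    rw [sub_smul, ← add_sub_assoc, this, add_sub_cancel_right]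
  have hst : s - t = 0 := (h v (hsub hv)).unique (by rw [← hw']; exact hw) (by simpa using hv)
  rw [hst, zero_smul, add_zero] at hw'
  rw [hw', sub_eq_zero.1 hst]

theorem map_add_smul_eq {M : Type*} [AddCommGroup M] [Module K M] (f : QuadraticForm K M)
    (v n : M) (t : K) :
    f (v + t • n) = f v + t * QuadraticMap.polar f v n + t ^ 2 * f n := by
  rw [QuadraticMap.map_add f, QuadraticMap.polar_smul_right, QuadraticMap.map_smul, smul_eq_mul,
    smul_eq_mul]
  ring

/-- Lines in the direction of a non-singular vector of the radical contain exactly one zero. -/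
theorem existsUnique_zero_of_radical [Finite K] [CharP K 2] {M : Type*} [AddCommGroup M]
    [Module K M] (f : QuadraticForm K M) {n : M} (hn : f n ≠ 0)
    (hpol : ∀ w, QuadraticMap.polar f n w = 0) (v : M) : ∃! t : K, f (v + t • n) = 0 := by
  have hval : ∀ t : K, f (v + t • n) = f v + t ^ 2 * f n := by
    intro t
    rw [map_add_smul_eq, QuadraticMap.polar_comm, hpol, mul_zero, add_zero]
  -- There is no term linear in t, so a zero is a square root of f v / f n, and square roots exist
  -- and are unique.
  obtain ⟨s, hs⟩ := exists_sq_eq (f v / f n)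
  have hs' : f v = s ^ 2 * f n := by rw [hs, div_mul_cancel₀ _ hn]
  refine ⟨s, (hval s).trans (by rw [hs', CharTwo.add_self_eq_zero]), fun t ht => ?_⟩
  have ht : f (v + t • n) = 0 := ht
  rw [hval, hs', ← add_mul, ← CharTwo.add_sq] at ht
  exact (CharTwo.add_eq_zero.1
    (pow_eq_zero_iff two_ne_zero |>.1 ((mul_eq_zero.1 ht).resolve_right hn))).symm

theorem hyperbolicForm_apply (k : ℕ) (z : Fin k → K × K) :
    hyperbolicForm K k z = ∑ i, (z i).1 * (z i).2 := by
  simp [hyperbolicForm]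

theorem parabolicForm_apply (k : ℕ) (x : K) (z : Fin k → K × K) :
    parabolicForm K k (x, z) = x ^ 2 + ∑ i, (z i).1 * (z i).2 := by
  simp [parabolicForm, hyperbolicForm_apply, sq]

/-- The term x₀² is additive in characteristic two and drops out; hence (1, 0) lies in the radical
and spans the nucleus. -/
theorem polar_parabolicForm [CharP K 2] (k : ℕ) (v w : K × (Fin k → K × K)) :
    QuadraticMap.polar (parabolicForm K k) v w =
      ∑ i, ((v.2 i).1 * (w.2 i).2 + (v.2 i).2 * (w.2 i).1) := by
  obtain ⟨x, z⟩ := v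
  obtain ⟨y, u⟩ := w
  simp only [QuadraticMap.polar, Prod.mk_add_mk, parabolicForm_apply, CharTwo.add_sq, Pi.add_apply,
    Prod.fst_add, Prod.snd_add]
  rw [show ∀ a b c d e : K, a + b + c - (a + d) - (b + e) = c - d - e by intros; ring,
    ← Finset.sum_sub_distrib, ← Finset.sum_sub_distrib]
  exact Finset.sum_congr rfl fun i _ => by ring

theorem parabolicForm_nondegenerate [CharP K 2] (k : ℕ) (v : K × (Fin k → K × K))
    (hpol : ∀ w, QuadraticMap.polar (parabolicForm K k) v w = 0)
    (h0 : parabolicForm K k v = 0) : v = 0 := by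
  classical
  obtain ⟨x, z⟩ := v
  have hz : z = 0 := by
    funext i
    have h1 := hpol (0, Pi.single i (1, 0))
    have h2 := hpol (0, Pi.single i (0, 1))
    rw [polar_parabolicForm, Finset.sum_eq_single i (by intro j _ hj; simp [hj]) (by simp)] at h1 h2
    ext
    · simpa using h2
    · simpa using h1
  subst hz
  simpa [parabolicForm_apply] using h0

theorem finrank_parabolic_space (k : ℕ) : Module.finrank K (K × (Fin k → K × K)) = 2 * k + 1 := by
  rw [Module.finrank_prod, Module.finrank_self, Module.finrank_pi_fintype]
  simp
  ring

/-- If ker φ contains (1, 0), each of its lines in that direction has one zero, and ε = 0. Otherwise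
φ = 0 determines x₀ as a linear function of z. Squaring is additive, so the restricted form becomes
∑ ((bᵢxᵢ + cᵢyᵢ)² + xᵢyᵢ), an orthogonal sum of binary forms of sign ±1. -/
theorem exists_ncard_parabolicForm_inter_ker [Finite K] [CharP K 2] (k : ℕ)
    (φ : Module.Dual K (K × (Fin k → K × K))) (hφ : φ ≠ 0) :
    ∃ ε : ℤ, (ε = 0 ∨ ε = 1 ∨ ε = -1) ∧
      (Nat.card K : ℤ) * {v | φ v = 0 ∧ parabolicForm K k v = 0}.ncard =
        Nat.card K ^ (2 * k) + ε * Nat.card K ^ k * (Nat.card K - 1) := by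
  classical
  by_cases h1 : φ (1, 0) = 0
  · refine ⟨0, Or.inl rfl, ?_⟩
    have hcount := ncard_eq_mul_of_existsUnique_translate (K := K) (1, 0)
      (A := {v | φ v = 0}) (A₀ := {v | φ v = 0 ∧ parabolicForm K k v = 0}) (fun v hv => hv.1)
      (fun v hv t => by
        have hv : φ v = 0 := hv
        rw [Set.mem_ofPred_eq, map_add, map_smul, hv, h1, smul_zero, add_zero]) (by
        intro v hv
        have hv : φ v = 0 := hv
        have := existsUnique_zero_of_radical (parabolicForm K k) (n := (1, 0))
          (by simp [parabolicForm_apply]) (fun w => by simp [polar_parabolicForm]) v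
        simpa only [Set.mem_ofPred_eq, map_add, map_smul, hv, h1, smul_zero, add_zero,
          true_and] using this)
    have hker : {v | φ v = 0}.ncard = Nat.card K ^ (2 * k) := by
      have := Module.natCard_eq_pow_finrank (K := K) (V := LinearMap.ker φ)
      rw [show {v | φ v = 0}.ncard = Nat.card (LinearMap.ker φ) from rfl, this]
      have h3 := Module.Dual.finrank_ker_add_one_of_ne_zero hφ
      congr 1
      rw [finrank_parabolic_space] at h3
      omega
    rw [hker] at hcount
    zify at hcount
    rw [← hcount]; ring
  · set a : K := φ (1, 0) with ha
    have hφv : ∀ x z, φ (x, z) = x * a + φ (0, z) := by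
      intro x z
      rw [ha, ← smul_eq_mul, ← map_smul, ← map_add]
      simp
    have hφz : ∀ z : Fin k → K × K, a⁻¹ * φ (0, z) =
        ∑ i, (a⁻¹ * φ (0, Pi.single i (1, 0)) * (z i).1 +
          a⁻¹ * φ (0, Pi.single i (0, 1)) * (z i).2) := by
      intro z
      have hz : (0, z) = ∑ i, ((z i).1 • ((0 : K), (Pi.single i (1, 0) : Fin k → K × K)) +
          (z i).2 • ((0 : K), (Pi.single i (0, 1) : Fin k → K × K))) := by
        refine Prod.ext ?_ ?_
        · simp [Prod.fst_sum]
        · funext j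
          simp [Prod.snd_sum, Finset.sum_apply, Finset.sum_add_distrib, Pi.single_apply]
      rw [hz, map_sum, Finset.mul_sum]
      refine Finset.sum_congr rfl fun i _ => ?_
      rw [map_add, map_smul, map_smul, smul_eq_mul, smul_eq_mul]
      ring
    choose ε hε hcount using fun i : Fin k => exists_hasLevelCounts_binary
      (a⁻¹ * φ (0, Pi.single i (1, 0))) (a⁻¹ * φ (0, Pi.single i (0, 1)))
    have hpi := HasLevelCounts.pi k _ ε hcount 0
    refine ⟨∏ i, ε i, Or.inr ?_, ?_⟩
    · refine Finset.prod_induction ε (fun e => e = 1 ∨ e = -1) ?_ (Or.inl rfl) fun i _ => hε i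
      rintro _ _ (rfl | rfl) (rfl | rfl) <;> simp
    · rw [if_pos rfl] at hpi
      rw [← hpi]
      congr 2
      refine Set.ncard_congr (fun v _ => v.2) ?_ ?_ ?_
      · rintro ⟨x, z⟩ ⟨h, h'⟩
        rw [hφv] at h
        have hx : x = a⁻¹ * φ (0, z) := by
          rw [eq_inv_mul_iff_mul_eq₀ h1, mul_comm]; exact CharTwo.add_eq_zero.1 h
        rw [parabolicForm_apply, hx, hφz, CharTwo.sum_sq, ← Finset.sum_add_distrib] at h'
        exact h'
      · rintro ⟨x, z⟩ ⟨y, w⟩ ⟨h, -⟩ ⟨h', -⟩ hzw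
        obtain rfl : z = w := hzw
        rw [hφv] at h h'
        have : x * a = y * a := add_right_cancel (h.trans h'.symm)
        rw [mul_right_cancel₀ h1 this]
      · intro z hz
        refine ⟨(a⁻¹ * φ (0, z), z), ⟨?_, ?_⟩, rfl⟩
        · rw [hφv, mul_comm, mul_inv_cancel_left₀ h1, CharTwo.add_self_eq_zero]
        · rw [parabolicForm_apply, hφz, CharTwo.sum_sq, ← Finset.sum_add_distrib]
          exact hz

theorem exists_dual_ker_eq {M : Type*} [AddCommGroup M] [Module K M] [FiniteDimensional K M]
    (U : Submodule K M) (hU : Module.finrank K U + 1 = Module.finrank K M) :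
    ∃ φ : Module.Dual K M, φ ≠ 0 ∧ LinearMap.ker φ = U := by
  have hlt : U < ⊤ := lt_top_iff_ne_top.2 (by rintro rfl; simp at hU)
  obtain ⟨φ, hφ, hle⟩ := U.exists_le_ker_of_lt_top hlt
  refine ⟨φ, hφ, (Submodule.eq_of_le_of_finrank_eq hle ?_).symm⟩
  have := Module.Dual.finrank_ker_add_one_of_ne_zero hφ
  omega

variable {M : Type*} [AddCommGroup M] [Module K M] {f : QuadraticForm K M} {k : ℕ}

theorem finrank_of_equivalent_parabolicForm (h : f.Equivalent (parabolicForm K k)) :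
    Module.finrank K M = 2 * k + 1 := by
  obtain ⟨e⟩ := h
  rw [e.toLinearEquiv.finrank_eq]
  exact finrank_parabolic_space k

theorem nondegenerate_of_equivalent_parabolicForm [CharP K 2]
    (h : f.Equivalent (parabolicForm K k)) (v : M)
    (hpol : ∀ w, QuadraticMap.polar f v w = 0) (h0 : f v = 0) : v = 0 := by
  obtain ⟨e⟩ := h
  rw [← e.toLinearEquiv.map_eq_zero_iff]
  refine parabolicForm_nondegenerate k _ (fun w => ?_) ((e.map_app v).trans h0)
  have := hpol (e.toLinearEquiv.symm w)
  rw [← this]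
  simp only [QuadraticMap.polar, ← e.map_app]
  simp

theorem exists_radical_of_equivalent_parabolicForm [CharP K 2]
    (h : f.Equivalent (parabolicForm K k)) :
    ∃ v : M, f v = 1 ∧ ∀ w, QuadraticMap.polar f v w = 0 := by
  obtain ⟨e⟩ := h
  refine ⟨e.symm (1, 0), ?_, fun w => ?_⟩
  · rw [QuadraticMap.IsometryEquiv.map_app, parabolicForm_apply]; simp
  · have := polar_parabolicForm k (1, 0) (e w)
    simp only [QuadraticMap.polar, ← e.map_app] at this ⊢
    simpa using this

theorem exists_ncard_zeros_inter [Finite K] [CharP K 2] [FiniteDimensional K M]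
    (h : f.Equivalent (parabolicForm K k)) (U : Submodule K M)
    (hU : Module.finrank K U + 1 = Module.finrank K M) :
    ∃ ε : ℤ, (ε = 0 ∨ ε = 1 ∨ ε = -1) ∧
      (Nat.card K : ℤ) * {v | v ∈ U ∧ f v = 0}.ncard =
        Nat.card K ^ (2 * k) + ε * Nat.card K ^ k * (Nat.card K - 1) := by
  obtain ⟨φ, hφ, rfl⟩ := exists_dual_ker_eq U hU
  obtain ⟨e⟩ := h
  obtain ⟨ε, hε, hcount⟩ := exists_ncard_parabolicForm_inter_ker k
    (φ ∘ₗ (e.toLinearEquiv.symm : _ →ₗ[K] M)) (fun h0 => hφ (by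
      ext v
      simpa using LinearMap.congr_fun h0 (e.toLinearEquiv v)))
  refine ⟨ε, hε, ?_⟩
  rw [← hcount]
  congr 2
  refine Set.ncard_congr' (Equiv.subtypeEquiv e.toLinearEquiv.toEquiv fun v => ?_)
  simp

/-- The number of zeros of a parabolic form. -/
theorem ncard_zeros_of_equivalent_parabolicForm [Finite K] [CharP K 2] [FiniteDimensional K M]
    (h : f.Equivalent (parabolicForm K k)) :
    {v | f v = 0}.ncard = Nat.card K ^ (2 * k) := by
  have : Finite M := Module.finite_of_finite K
  obtain ⟨n, hn, hpol⟩ := exists_radical_of_equivalent_parabolicForm h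
  have hcount := ncard_eq_mul_of_existsUnique_translate (K := K) n (A := Set.univ)
    (A₀ := {v | f v = 0}) (Set.subset_univ _) (fun _ _ _ => Set.mem_univ _)     (fun v _ => existsUnique_zero_of_radical f (by simp [hn]) hpol v)
  rw [Set.ncard_univ, Module.natCard_eq_pow_finrank (K := K),
    finrank_of_equivalent_parabolicForm h, pow_succ'] at hcount
  exact (Nat.eq_of_mul_eq_mul_left Nat.card_pos hcount).symm

theorem hasLevelCounts_hyperbolicForm [Finite K] [CharP K 2] (k : ℕ) :
    HasLevelCounts (hyperbolicForm K k) k 1 := by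
  have h1 : HasLevelCounts (fun z : K × K => z.1 * z.2) 1 1 := by
    refine hasLevelCounts_of_ncard_zeros _ (fun t v => ?_) card_prod_self ?_
    · simp only [Prod.smul_fst, Prod.smul_snd, smul_eq_mul]; ring
    · have hset : {z : K × K | z.1 * z.2 = 0} =
          Set.range (fun t : K => t • ((1 : K), (0 : K))) ∪
            Set.range (fun t : K => t • ((0 : K), (1 : K))) := by
        ext ⟨x, y⟩
        simp [or_comm, eq_comm]
      have := ncard_line_union_line (K := K) (u := (1, 0)) (w := (0, 1)) (by simp) (by simp)
      rw [← hset] at this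
      zify at this
      rw [eq_sub_of_add_eq this]; ring
  have := HasLevelCounts.pi k (fun _ => fun z : K × K => z.1 * z.2) (fun _ => 1) fun _ => h1
  rw [Finset.prod_const_one] at this
  convert this using 1
  funext z
  exact hyperbolicForm_apply k z

theorem ncard_zeros_eq_of_equivalent {M' : Type*} [AddCommGroup M'] [Module K M']
    {f' : QuadraticForm K M'} (h : f.Equivalent f') :
    {v | f v = 0}.ncard = {v | f' v = 0}.ncard := by
  obtain ⟨e⟩ := h
  refine Set.ncard_congr' (Equiv.subtypeEquiv e.toLinearEquiv.toEquiv fun v => ?_)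
  have h1 : f' (e.toLinearEquiv v) = f v := e.map_app v
  exact iff_of_eq (congrArg (· = 0) h1.symm)

theorem ncard_zeros_of_equivalent_hyperbolicForm [Finite K] [CharP K 2]
    (h : f.Equivalent (hyperbolicForm K k)) :
    (Nat.card K : ℤ) * {v | f v = 0}.ncard =
      Nat.card K ^ (2 * k) + Nat.card K ^ k * (Nat.card K - 1) := by
  rw [ncard_zeros_eq_of_equivalent h, hasLevelCounts_hyperbolicForm k 0, if_pos rfl]
  ring

theorem ncard_zeros_of_equivalent_ellipticForm [Finite K] [CharP K 2]
    {g : QuadraticForm K (K × K)} (hg : g.Anisotropic) (h : f.Equivalent (ellipticForm g k)) :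
    (Nat.card K : ℤ) * {v | f v = 0}.ncard =
      Nat.card K ^ (2 * (k + 1)) - Nat.card K ^ (k + 1) * (Nat.card K - 1) := by
  have := ((hasLevelCounts_anisotropic g hg).prod (hasLevelCounts_hyperbolicForm k)) 0
  rw [if_pos rfl, add_comm 1 k] at this
  rw [ncard_zeros_eq_of_equivalent h]
  refine Eq.trans ?_ (this.trans (by ring))
  rfl

end ParabolicForms

/-! ### Dictionary between sets of points and sets of vectors. -/

section VectorsOf

variable {K : Type*} [Field K] {V : Type*} [AddCommGroup V] [Module K V]

/-- The vectors spanning a point of `S`, together with the zero vector. -/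
def vectorsOf (S : Set (ℙ K V)) : Set V := {v | ∀ h : v ≠ 0, Projectivization.mk K v h ∈ S}

theorem mem_vectorsOf_iff {S : Set (ℙ K V)} {v : V} (hv : v ≠ 0) :
    v ∈ vectorsOf S ↔ Projectivization.mk K v hv ∈ S :=
  ⟨fun h => h hv, fun h _ => h⟩

theorem zero_mem_vectorsOf (S : Set (ℙ K V)) : (0 : V) ∈ vectorsOf S := fun h => absurd rfl h

theorem smul_mem_vectorsOf {S : Set (ℙ K V)} {v : V} (h : v ∈ vectorsOf S) (t : K) :
    t • v ∈ vectorsOf S := by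
  intro htv
  have hv : v ≠ 0 := right_ne_zero_of_smul htv
  convert h hv using 1
  exact (Projectivization.mk_eq_mk_iff' K _ _ htv hv).2 ⟨t, rfl⟩

theorem smul_mem_vectorsOf_iff {S : Set (ℙ K V)} {v : V} {t : K} (ht : t ≠ 0) :
    t • v ∈ vectorsOf S ↔ v ∈ vectorsOf S := by
  refine ⟨fun h => ?_, fun h => smul_mem_vectorsOf h t⟩
  simpa [smul_smul, ht] using smul_mem_vectorsOf h t⁻¹

theorem vectorsOf_injective : Function.Injective (vectorsOf (K := K) (V := V)) := by
  intro S T h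
  ext p
  induction p with
  | h v hv => rw [← mem_vectorsOf_iff hv, ← mem_vectorsOf_iff hv, h]

theorem vectorsOf_inter (S T : Set (ℙ K V)) :
    vectorsOf (S ∩ T) = vectorsOf S ∩ vectorsOf T := by
  ext v
  exact ⟨fun h => ⟨fun hv => (h hv).1, fun hv => (h hv).2⟩, fun h hv => ⟨h.1 hv, h.2 hv⟩⟩

theorem mem_vectorsOf_union {S T : Set (ℙ K V)} {v : V} :
    v ∈ vectorsOf (S ∪ T) ↔ v ∈ vectorsOf S ∨ v ∈ vectorsOf T := by
  by_cases hv : v = 0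
  · subst hv; simp [zero_mem_vectorsOf]
  · simp [mem_vectorsOf_iff hv]

theorem mem_vectorsOf_diff {S T : Set (ℙ K V)} {v : V} (hv : v ≠ 0) :
    v ∈ vectorsOf (S \ T) ↔ v ∈ vectorsOf S ∧ v ∉ vectorsOf T := by
  simp [mem_vectorsOf_iff hv]

theorem mk_mem_pointsOf {W : Submodule K V} {v : V} {hv : v ≠ 0} :
    Projectivization.mk K v hv ∈ pointsOf W ↔ v ∈ W := by
  simp [pointsOf]

theorem vectorsOf_pointsOf (W : Submodule K V) : vectorsOf (pointsOf W) = W := by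
  ext v
  by_cases hv : v = 0
  · subst hv; simp [zero_mem_vectorsOf]
  · rw [mem_vectorsOf_iff hv, mk_mem_pointsOf, SetLike.mem_coe]

theorem mem_vectorsOf_quadricOf {W : Submodule K V} {f : QuadraticForm K W} {v : V} :
    v ∈ vectorsOf (quadricOf W f) ↔ ∃ h : v ∈ W, f ⟨v, h⟩ = 0 := by
  by_cases hv : v = 0
  · subst hv
    simp only [zero_mem_vectorsOf, true_iff]
    exact ⟨W.zero_mem, map_zero f⟩
  · rw [mem_vectorsOf_iff hv]
    constructor
    · rintro ⟨h, h'⟩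
      exact ⟨mk_mem_pointsOf.1 h, h' _ (by simp [Submodule.mem_span_singleton_self])⟩
    · rintro ⟨h, h'⟩
      refine ⟨mk_mem_pointsOf.2 h, ?_⟩
      rintro ⟨w, hw⟩ hwv
      obtain ⟨t, rfl⟩ := Submodule.mem_span_singleton.1 hwv
      have : (⟨t • v, hw⟩ : W) = t • ⟨v, h⟩ := rfl
      rw [this, QuadraticMap.map_smul, h', smul_zero]

/-- Since 0 always belongs to `vectorsOf C`, the choice u = 0 covers the vertex, and the cone is a
union of lines of direction p. -/
theorem mem_vectorsOf_cone {p : V} (hp : p ≠ 0) {C : Set (ℙ K V)} {v : V} :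
    v ∈ vectorsOf (cone (Projectivization.mk K p hp) C) ↔
      ∃ t : K, ∃ u ∈ vectorsOf C, v = u + t • p := by
  by_cases hv : v = 0
  · subst hv
    simp only [zero_mem_vectorsOf, true_iff]
    exact ⟨0, 0, zero_mem_vectorsOf C, by simp⟩
  rw [mem_vectorsOf_iff hv]
  constructor
  · rintro (h | ⟨X, hX, h⟩)
    · obtain ⟨t, rfl⟩ := (Projectivization.mk_eq_mk_iff' K _ _ hv hp).1 h
      exact ⟨t, 0, zero_mem_vectorsOf C, by simp⟩
    · induction X with
      | h x hx =>
        rw [Projectivization.submodule_mk, Projectivization.submodule_mk,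
          Projectivization.submodule_mk, Submodule.span_singleton_le_iff_mem,
          Submodule.mem_sup] at h
        obtain ⟨y, hy, z, hz, rfl⟩ := h
        obtain ⟨t, rfl⟩ := Submodule.mem_span_singleton.1 hy
        obtain ⟨s, rfl⟩ := Submodule.mem_span_singleton.1 hz
        exact ⟨t, s • x, smul_mem_vectorsOf ((mem_vectorsOf_iff hx).2 hX) s, add_comm _ _⟩
  · rintro ⟨t, u, hu, rfl⟩
    by_cases hu0 : u = 0
    · subst hu0
      exact Or.inl ((Projectivization.mk_eq_mk_iff' K _ _ hv hp).2 ⟨t, by simp⟩)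
    · refine Or.inr ⟨_, (mem_vectorsOf_iff hu0).1 hu, ?_⟩
      rw [Projectivization.submodule_mk, Projectivization.submodule_mk,
        Projectivization.submodule_mk, Submodule.span_singleton_le_iff_mem]
      exact add_comm u (t • p) ▸ Submodule.add_mem_sup
        (Submodule.smul_mem _ t (Submodule.mem_span_singleton_self p))
        (Submodule.mem_span_singleton_self u)

/-- Each point carries q - 1 nonzero vectors; the final 1 counts the zero vector. -/
theorem ncard_vectorsOf [Finite K] [Finite V] (S : Set (ℙ K V)) :
    (vectorsOf S).ncard = (Nat.card K - 1) * S.ncard + 1 := by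
  have himg : vectorsOf S =
      insert 0 ((fun x : ℙ K V × Kˣ => x.2 • x.1.rep) '' (S ×ˢ Set.univ)) := by
    ext v
    by_cases hv : v = 0
    · subst hv; simp [zero_mem_vectorsOf]
    rw [Set.mem_insert_iff, or_iff_right hv, mem_vectorsOf_iff hv]
    simp only [Set.mem_image, Set.mem_prod, Set.mem_univ, and_true, Prod.exists]
    constructor
    · intro h
      obtain ⟨a, ha⟩ := Projectivization.exists_smul_eq_mk_rep K v hv
      exact ⟨_, a⁻¹, h, by rw [← ha, inv_smul_smul]⟩
    · rintro ⟨p, a, hp, rfl⟩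
      convert hp
      conv_rhs => rw [← p.mk_rep]
      exact (Projectivization.mk_eq_mk_iff K _ _ _ _).2 ⟨a, rfl⟩
  have hmk : ∀ (p : ℙ K V) (a : Kˣ) (h : a • p.rep ≠ 0), Projectivization.mk K (a • p.rep) h = p := by
    intro p a h
    conv_rhs => rw [← p.mk_rep]
    exact (Projectivization.mk_eq_mk_iff K _ _ _ _).2 ⟨a, rfl⟩
  have hne : ∀ (p : ℙ K V) (a : Kˣ), a • p.rep ≠ 0 := fun p a =>
    (smul_ne_zero_iff_ne a).2 p.rep_nonzero
  rw [himg, Set.ncard_insert_of_notMem, Set.InjOn.ncard_image, Set.ncard_prod, Set.ncard_univ,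
    Nat.card_units, mul_comm]
  · rintro ⟨p, a⟩ - ⟨r, b⟩ - h
    have h : a • p.rep = b • r.rep := h
    have hpr : p = r := by
      rw [← hmk p a (hne p a), ← hmk r b (hne r b)]
      congr 1
    subst hpr
    rw [Units.smul_def, Units.smul_def] at h
    rw [Units.ext (smul_left_injective K p.rep_nonzero h)]
  · rintro ⟨⟨p, a⟩, -, h⟩
    exact hne p a h

theorem ncard_eq_of_ncard_vectorsOf_eq [Finite K] [Finite V] {S T : Set (ℙ K V)}
    (h : (vectorsOf S).ncard = (vectorsOf T).ncard) : S.ncard = T.ncard := by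
  rw [ncard_vectorsOf, ncard_vectorsOf] at h
  have : 1 < Nat.card K := Finite.one_lt_card
  exact Nat.eq_of_mul_eq_mul_left (by omega) (Nat.add_right_cancel h)

theorem ncard_vectorsOf_quadricOf {W : Submodule K V} (f : QuadraticForm K W) :
    (vectorsOf (quadricOf W f)).ncard = {w : W | f w = 0}.ncard := by
  rw [← Set.ncard_image_of_injective _ Subtype.val_injective]
  congr 1
  ext v
  rw [mem_vectorsOf_quadricOf]
  simp

/-- A nucleus in terms of vectors. -/
theorem isNucleus_mk_iff {W : Submodule K V} {S : Set (ℙ K V)} {n : V} (hn : n ≠ 0) :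
    IsNucleus W S (Projectivization.mk K n hn) ↔ n ∈ W ∧ n ∉ vectorsOf S ∧
      ∀ v ∈ W, v ∉ Submodule.span K {n} → ∃! t : K, v + t • n ∈ vectorsOf S := by
  have hadd : ∀ {v : V}, v ∉ Submodule.span K {n} → ∀ t : K, v + t • n ≠ 0 := by
    intro v hv t h
    refine hv (Submodule.mem_span_singleton.2 ⟨-t, ?_⟩)
    rw [neg_smul]
    exact (eq_neg_of_add_eq_zero_left h).symm
  have hspan : ∀ {v : V}, v ∉ Submodule.span K {n} →
      Module.finrank K (Submodule.span K {n, v}) = 2 := by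
    intro v hv
    have hli : LinearIndependent K ![n, v] := by
      rw [LinearIndependent.pair_iff' hn]
      intro a ha
      exact hv (Submodule.mem_span_singleton.2 ⟨a, ha⟩)
    have h := finrank_span_eq_card hli
    rwa [Matrix.range_cons_cons_empty, Fintype.card_fin] at h
  rw [IsNucleus, mk_mem_pointsOf, ← mem_vectorsOf_iff hn]
  refine and_congr_right fun hnW => and_congr_right fun hnS => ⟨fun h v hv hvn => ?_,
    fun h L hL hL2 hnL => ?_⟩
  · obtain ⟨X, ⟨hXS, hXL⟩, huniq⟩ := h (Submodule.span K {n, v})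
      (Submodule.span_le.2 (Set.insert_subset hnW (Set.singleton_subset_iff.2 hv))) (hspan hvn)
      (mk_mem_pointsOf.2 (Submodule.subset_span (by simp)))
    induction X with
    | h x hx =>
      rw [mk_mem_pointsOf, Submodule.mem_span_pair] at hXL
      obtain ⟨a, b, rfl⟩ := hXL
      rw [← mem_vectorsOf_iff] at hXS
      -- With b = 0 the point would be that of n, which is not in S. So the vector can be rescaled
      -- to the form v + t • n.
      have hb : b ≠ 0 := by
        rintro rfl
        rw [zero_smul, add_zero] at hXS hx
        exact hnS ((smul_mem_vectorsOf_iff (left_ne_zero_of_smul hx)).1 hXS)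
      refine ⟨b⁻¹ * a, ?_, fun t ht => ?_⟩
      · refine (smul_mem_vectorsOf_iff hb).1 ?_
        convert hXS using 1
        rw [smul_add, smul_smul, mul_inv_cancel_left₀ hb, add_comm]
      · have := huniq (Projectivization.mk K (v + t • n) (hadd hvn t))
          ⟨(mem_vectorsOf_iff _).1 ht, mk_mem_pointsOf.2
            (Submodule.mem_span_pair.2 ⟨t, 1, by rw [one_smul, add_comm]⟩)⟩
        obtain ⟨c, hc⟩ := (Projectivization.mk_eq_mk_iff' K _ _ _ _).1 this
        have hli := (LinearIndependent.pair_iff (R := K)).1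
          ((LinearIndependent.pair_iff' hn).2 fun a ha =>
            hvn (Submodule.mem_span_singleton.2 ⟨a, ha⟩)) (c * a - t) (c * b - 1) (by
              rw [sub_smul, sub_smul, one_smul, mul_smul, mul_smul,
                ← sub_eq_zero.2 hc]
              module)
        have h1 : c * b = 1 := sub_eq_zero.1 hli.2
        rw [← sub_eq_zero.1 hli.1, eq_inv_of_mul_eq_one_left h1]
  · have hlt : Submodule.span K {n} < L := by
      refine lt_of_le_of_ne ((Submodule.span_singleton_le_iff_mem _ _).2 (mk_mem_pointsOf.1 hnL)) ?_
      rintro rfl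
      rw [finrank_span_singleton hn] at hL2
      omega
    obtain ⟨v, hvL, hvn⟩ := SetLike.exists_of_lt hlt
    have : FiniteDimensional K L := Module.finite_of_finrank_pos (by omega)
    have hLeq : Submodule.span K {n, v} = L := Submodule.eq_of_le_of_finrank_eq
      (Submodule.span_le.2 (Set.insert_subset (mk_mem_pointsOf.1 hnL)
        (Set.singleton_subset_iff.2 hvL))) ((hspan hvn).trans hL2.symm)
    obtain ⟨t, ht, huniq⟩ := h v (hL hvL) hvn
    refine ⟨Projectivization.mk K _ (hadd hvn t), ⟨(mem_vectorsOf_iff _).1 ht, mk_mem_pointsOf.2 ?_⟩,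
      ?_⟩
    · exact L.add_mem hvL (L.smul_mem t (mk_mem_pointsOf.1 hnL))
    · rintro Y ⟨hYS, hYL⟩
      induction Y with
      | h y hy =>
        rw [mk_mem_pointsOf, ← hLeq, Submodule.mem_span_pair] at hYL
        obtain ⟨a, b, rfl⟩ := hYL
        rw [← mem_vectorsOf_iff] at hYS
        have hb : b ≠ 0 := by
          rintro rfl
          rw [zero_smul, add_zero] at hYS hy
          exact hnS ((smul_mem_vectorsOf_iff (left_ne_zero_of_smul hy)).1 hYS)
        have hya : a • n + b • v = b • (v + (b⁻¹ * a) • n) := by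
          rw [smul_add, smul_smul, mul_inv_cancel_left₀ hb, add_comm]
        have : b⁻¹ * a = t := by
          refine huniq _ ?_
          rw [hya, smul_mem_vectorsOf_iff hb] at hYS
          exact hYS
        exact (Projectivization.mk_eq_mk_iff' K _ _ _ _).2 ⟨b, by rw [hya, this]⟩

end VectorsOf

/-! ### Hyperplane sections of cones and quadrics, and nuclei of quadrics. -/

section Hyperplanes

variable {K : Type*} [Field K] {V : Type*} [AddCommGroup V] [Module K V]

theorem IsHyperplaneOf.exists_dual [FiniteDimensional K V] {H : Submodule K V}
    (hH : IsHyperplaneOf H ⊤) : ∃ φ : Module.Dual K V, φ ≠ 0 ∧ LinearMap.ker φ = H :=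
  exists_dual_ker_eq H (by rw [hH.2, finrank_top])

theorem finrank_comap_subtype_ker [FiniteDimensional K V] {φ : Module.Dual K V} {W : Submodule K V}
    (h : ¬ W ≤ LinearMap.ker φ) :
    Module.finrank K ((LinearMap.ker φ).comap W.subtype) + 1 = Module.finrank K W := by
  rw [← LinearMap.ker_comp]
  refine Module.Dual.finrank_ker_add_one_of_ne_zero (f := φ ∘ₗ W.subtype) fun h0 => h fun v hv => ?_
  exact LinearMap.congr_fun h0 ⟨v, hv⟩

theorem ncard_coe_submodule [Finite K] [FiniteDimensional K V] (W : Submodule K V) :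
    (W : Set V).ncard = Nat.card K ^ Module.finrank K W :=
  Module.natCard_eq_pow_finrank (K := K) (V := W)

theorem ncard_inter_ker [Finite K] [FiniteDimensional K V] {φ : Module.Dual K V}
    {W : Submodule K V} (h : ¬ W ≤ LinearMap.ker φ) :
    Nat.card K * ((W : Set V) ∩ LinearMap.ker φ).ncard = Nat.card K ^ Module.finrank K W := by
  rw [← finrank_comap_subtype_ker h, pow_succ', ← ncard_coe_submodule,
    ← Set.ncard_image_of_injective _ Subtype.val_injective]
  congr 2
  ext v
  simp [and_comm]

theorem sup_span_eq_of_isHyperplaneOf [FiniteDimensional K V] {U W : Submodule K V}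
    (hU : IsHyperplaneOf U W) {p : V} (hpW : p ∈ W) (hpU : p ∉ U) :
    U ⊔ Submodule.span K {p} = W := by
  refine Submodule.eq_of_le_of_finrank_le
    (sup_le hU.1 ((Submodule.span_singleton_le_iff_mem _ _).2 hpW)) ?_
  have hlt : U < U ⊔ Submodule.span K {p} := by
    refine lt_of_le_of_ne le_sup_left fun h => hpU ?_
    rw [h]
    exact Submodule.mem_sup_right (Submodule.mem_span_singleton_self p)
  have := Submodule.finrank_lt_finrank_of_lt hlt
  have := hU.2
  omega

theorem exists_eq_add_smul_of_isHyperplaneOf [FiniteDimensional K V] {U W : Submodule K V}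
    (hU : IsHyperplaneOf U W) {p : V} (hpW : p ∈ W) (hpU : p ∉ U) {v : V} (hv : v ∈ W) :
    ∃ u ∈ U, ∃ t : K, v = u + t • p := by
  rw [← sup_span_eq_of_isHyperplaneOf hU hpW hpU, Submodule.mem_sup] at hv
  obtain ⟨u, hu, y, hy, rfl⟩ := hv
  obtain ⟨t, rfl⟩ := Submodule.mem_span_singleton.1 hy
  exact ⟨u, hu, t, rfl⟩

theorem existsUnique_add_smul_mem_ker {φ : Module.Dual K V} {p : V} (hp : φ p ≠ 0) (v : V) :
    ∃! t : K, φ (v + t • p) = 0 := by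
  have hval : ∀ t : K, φ (v + t • p) = φ v + t * φ p := fun t => by simp
  refine ⟨-φ v / φ p, (hval _).trans (by field_simp; ring), fun t ht => ?_⟩
  have ht : φ (v + t • p) = 0 := ht
  rw [hval] at ht
  field_simp
  linear_combination ht

/-! ### Cones -/

/-- When p ∈ H, the section consists of whole lines of direction p, each meeting U, hence C, exactly
once. -/
theorem ncard_vectorsOf_cone_inter_of_mem [Finite K] [Finite V] {U H : Submodule K V} {p : V}
    (hp : p ≠ 0) (hpU : p ∉ U) {C : Set (ℙ K V)} (hC : vectorsOf C ⊆ U) (hpH : p ∈ H) :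
    (vectorsOf (cone (Projectivization.mk K p hp) C) ∩ H).ncard =
      Nat.card K * (vectorsOf C ∩ H).ncard := by
  refine ncard_eq_mul_of_existsUnique_translate p ?_ ?_ ?_
  · rintro v ⟨hv, hvH⟩
    exact ⟨(mem_vectorsOf_cone hp).2 ⟨0, v, hv, by simp⟩, hvH⟩
  · rintro v ⟨hv, hvH⟩ t
    obtain ⟨s, u, hu, rfl⟩ := (mem_vectorsOf_cone hp).1 hv
    exact ⟨(mem_vectorsOf_cone hp).2 ⟨s + t, u, hu, by rw [add_smul, add_assoc]⟩,
      H.add_mem hvH (H.smul_mem t hpH)⟩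
  · rintro v ⟨hv, hvH⟩
    obtain ⟨s, u, hu, rfl⟩ := (mem_vectorsOf_cone hp).1 hv
    refine ⟨-s, ⟨by simpa using hu, H.add_mem hvH (H.smul_mem _ hpH)⟩, fun t ht => ?_⟩
    by_contra hne
    have hmem : (s + t) • p ∈ U := by
      have h1 := U.sub_mem (hC ht.1) (hC hu)
      rwa [add_assoc, ← add_smul, add_sub_cancel_left] at h1
    refine hpU ((U.smul_mem_iff fun h0 => hne ?_).1 hmem)
    linear_combination h0

theorem ncard_vectorsOf_cone [Finite K] [Finite V] {U : Submodule K V} {p : V}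
    (hp : p ≠ 0) (hpU : p ∉ U) {C : Set (ℙ K V)} (hC : vectorsOf C ⊆ U) :
    (vectorsOf (cone (Projectivization.mk K p hp) C)).ncard =
      Nat.card K * (vectorsOf C).ncard := by
  simpa using ncard_vectorsOf_cone_inter_of_mem hp hpU hC (H := ⊤) Submodule.mem_top

/-- Each line of direction p meets ker φ exactly once and, if it lies in the cone, meets C exactly
once. The section thus has a size independent of its position. -/
theorem ncard_vectorsOf_cone_inter_of_notMem [Finite K] [Finite V] {U : Submodule K V} {p : V}
    (hp : p ≠ 0) (hpU : p ∉ U) {C : Set (ℙ K V)} (hC : vectorsOf C ⊆ U) {φ : Module.Dual K V}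
    (hφ : φ p ≠ 0) :
    (vectorsOf (cone (Projectivization.mk K p hp) C) ∩ LinearMap.ker φ).ncard =
      (vectorsOf C).ncard := by
  refine Nat.eq_of_mul_eq_mul_left (Nat.card_pos (α := K)) ?_
  rw [← ncard_vectorsOf_cone hp hpU hC]
  refine (ncard_eq_mul_of_existsUnique_translate p Set.inter_subset_left ?_ ?_).symm
  · rintro v hv t
    obtain ⟨s, u, hu, rfl⟩ := (mem_vectorsOf_cone hp).1 hv
    exact (mem_vectorsOf_cone hp).2 ⟨s + t, u, hu, by rw [add_smul, add_assoc]⟩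
  · intro v hv
    obtain ⟨t, ht, huniq⟩ := existsUnique_add_smul_mem_ker hφ v
    obtain ⟨s, u, hu, rfl⟩ := (mem_vectorsOf_cone hp).1 hv
    exact ⟨t, ⟨(mem_vectorsOf_cone hp).2 ⟨s + t, u, hu, by rw [add_smul, add_assoc]⟩, ht⟩,
      fun t' ht' => huniq t' ht'.2⟩

/-! ### Quadrics -/

theorem vectorsOf_quadricOf_subset (W : Submodule K V) (f : QuadraticForm K W) :
    vectorsOf (quadricOf W f) ⊆ W := fun _ hv => (mem_vectorsOf_quadricOf.1 hv).1

/-- The image of the zero set of a form under an injective linear map is a quadric. -/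
theorem exists_quadricOf_range {M : Type*} [AddCommGroup M] [Module K M] (F : QuadraticForm K M)
    (ι : M →ₗ[K] V) (hι : Function.Injective ι) :
    ∃ f : QuadraticForm K (LinearMap.range ι), f.Equivalent F ∧
      ∀ x, ι x ∈ vectorsOf (quadricOf (LinearMap.range ι) f) ↔ F x = 0 := by
  let e := LinearEquiv.ofInjective ι hι
  refine ⟨F.comp e.symm.toLinearMap, ⟨⟨e.symm, fun _ => rfl⟩⟩, fun x => ?_⟩
  have he : ∀ h : ι x ∈ LinearMap.range ι, e.symm ⟨ι x, h⟩ = x := fun h =>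
    e.symm_apply_eq.2 rfl
  rw [mem_vectorsOf_quadricOf]
  simp [he]

theorem exists_quadraticForm_of_isParabolicQuadric_top {Q : Set (ℙ K V)}
    (h : IsParabolicQuadric ⊤ Q) :
    ∃ (k : ℕ) (F : QuadraticForm K V), F.Equivalent (parabolicForm K k) ∧
      vectorsOf Q = {v | F v = 0} := by
  obtain ⟨k, f, ⟨e⟩, rfl⟩ := h
  refine ⟨k, f.comp Submodule.topEquiv.symm.toLinearMap,
    ⟨⟨Submodule.topEquiv.symm.trans e.toLinearEquiv, fun v => e.map_app _⟩⟩, ?_⟩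
  ext v
  rw [mem_vectorsOf_quadricOf]
  exact ⟨fun ⟨_, h⟩ => h, fun h => ⟨trivial, h⟩⟩

theorem exists_ncard_vectorsOf_quadricOf_inter_ker [Finite K] [CharP K 2] [FiniteDimensional K V]
    {W : Submodule K V} {f : QuadraticForm K W} {k : ℕ} (hf : f.Equivalent (parabolicForm K k))
    {φ : Module.Dual K V} (hφ : ¬ W ≤ LinearMap.ker φ) :
    ∃ ε : ℤ, (ε = 0 ∨ ε = 1 ∨ ε = -1) ∧
      (Nat.card K : ℤ) * (vectorsOf (quadricOf W f) ∩ LinearMap.ker φ).ncard =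
        Nat.card K ^ (2 * k) + ε * Nat.card K ^ k * (Nat.card K - 1) := by
  obtain ⟨ε, hε, h⟩ := exists_ncard_zeros_inter hf _ (finrank_comap_subtype_ker hφ)
  refine ⟨ε, hε, ?_⟩
  rw [← h, ← Set.ncard_image_of_injective _ Subtype.val_injective]
  congr 3
  ext v
  simp only [Set.mem_inter_iff, mem_vectorsOf_quadricOf, SetLike.mem_coe, Set.mem_image,
    Submodule.mem_comap, Set.mem_ofPred_eq, Subtype.exists, Submodule.subtype_apply]
  constructor
  · rintro ⟨⟨h, h'⟩, h''⟩
    exact ⟨v, h, ⟨h'', h'⟩, rfl⟩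
  · rintro ⟨_, h, ⟨h'', h'⟩, rfl⟩
    exact ⟨⟨h, h'⟩, h''⟩

/-- A set of points is a parabolic quasi-quadric if its intersections with hyperplanes have the
right numbers of vectors. -/
theorem isParabolicQuasiQuadric_of_ncard_vectorsOf [Finite K] [CharP K 2] [FiniteDimensional K V]
    {m : ℕ} (hV : Module.finrank K V = 2 * (m + 1) + 1) {S : Set (ℙ K V)}
    (hS : ∀ φ : Module.Dual K V, φ ≠ 0 → ∃ ε : ℤ, (ε = 0 ∨ ε = 1 ∨ ε = -1) ∧
      (Nat.card K : ℤ) * (vectorsOf S ∩ LinearMap.ker φ).ncard =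
        Nat.card K ^ (2 * (m + 1)) + ε * Nat.card K ^ (m + 1) * (Nat.card K - 1)) :
    IsParabolicQuasiQuadric S := by
  have : Finite V := Module.finite_of_finite K
  intro H hH
  obtain ⟨φ, hφ, rfl⟩ := hH.exists_dual
  have hrank : Module.finrank K (LinearMap.ker φ) = 2 * (m + 1) := by
    have := hH.2
    rw [finrank_top] at this
    omega
  have hpi : ∀ k, Module.finrank K (Fin k → K × K) = 2 * k := by
    intro k
    rw [Module.finrank_pi_fintype]
    simp
    ring
  have hq : (Nat.card K : ℤ) ≠ 0 := by exact_mod_cast Nat.card_pos.ne'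
  have key : ∀ T : Set (ℙ K V), (Nat.card K : ℤ) * (vectorsOf S ∩ LinearMap.ker φ).ncard =
      (Nat.card K : ℤ) * (vectorsOf T).ncard →
      (S ∩ pointsOf (LinearMap.ker φ)).ncard = T.ncard := by
    intro T hT
    apply ncard_eq_of_ncard_vectorsOf_eq
    rw [vectorsOf_inter, vectorsOf_pointsOf]
    exact_mod_cast mul_left_cancel₀ hq hT
  obtain ⟨ε, hε, h⟩ := hS φ hφ
  -- The comparison sets are a cone, a hyperbolic and an elliptic quadric, carried into the
  -- hyperplane by linear isomorphisms that exist by equality of dimensions.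
  obtain rfl | rfl | rfl := hε
  · let e : (K × (K × (Fin m → K × K))) ≃ₗ[K] LinearMap.ker φ :=
      LinearEquiv.ofFinrankEq _ _ (by
        rw [hrank, Module.finrank_prod, finrank_parabolic_space, Module.finrank_self]; ring)
    let ι : (K × (Fin m → K × K)) →ₗ[K] V :=
      (LinearMap.ker φ).subtype ∘ₗ e.toLinearMap ∘ₗ LinearMap.inr K K (K × (Fin m → K × K))
    have hι : Function.Injective ι := Subtype.val_injective.comp
      (e.injective.comp LinearMap.inr_injective)
    let p : V := e (1, 0)
    have hpU : p ∉ LinearMap.range ι := by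
      rintro ⟨x, hx⟩
      have := congrArg Prod.fst (e.injective (Subtype.val_injective hx))
      exact zero_ne_one this
    have hp : p ≠ 0 := fun h0 => hpU (h0 ▸ Submodule.zero_mem _)
    obtain ⟨f, hf, hvec⟩ := exists_quadricOf_range (parabolicForm K m) ι hι
    have hrankU : Module.finrank K (LinearMap.range ι) = 2 * m + 1 := by
      rw [LinearMap.finrank_range_of_inj hι, finrank_parabolic_space]
    refine ⟨cone (Projectivization.mk K p hp) (quadricOf _ f), Or.inr (Or.inr ⟨_, LinearMap.range ι,
      _, mk_mem_pointsOf.2 (e (1, 0)).2, ⟨?_, ?_⟩, fun h => hpU (mk_mem_pointsOf.1 h),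
      ⟨m, f, hf, rfl⟩, rfl⟩), key _ ?_⟩
    · rintro _ ⟨x, rfl⟩
      exact (e (0, x)).2
    · rw [hrank, hrankU]; ring
    · rw [h, ncard_vectorsOf_cone hp hpU (vectorsOf_quadricOf_subset _ f),
        ncard_vectorsOf_quadricOf, ncard_zeros_of_equivalent_parabolicForm hf]
      push_cast; ring
  · let e : LinearMap.ker φ ≃ₗ[K] (Fin (m + 1) → K × K) :=
      LinearEquiv.ofFinrankEq _ _ (by rw [hrank, hpi])
    have hf : ((hyperbolicForm K (m + 1)).comp e.toLinearMap).Equivalent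
      (hyperbolicForm K (m + 1)) := ⟨⟨e, fun _ => rfl⟩⟩
    refine ⟨quadricOf _ _, Or.inl ⟨m + 1, _, hf, rfl⟩, key _ ?_⟩
    rw [h, ncard_vectorsOf_quadricOf, ncard_zeros_of_equivalent_hyperbolicForm hf]
    ring
  · obtain ⟨g, hg⟩ := exists_anisotropic (K := K)
    let e : LinearMap.ker φ ≃ₗ[K] (K × K) × (Fin m → K × K) :=
      LinearEquiv.ofFinrankEq _ _ (by
        rw [hrank, Module.finrank_prod, hpi, Module.finrank_prod, Module.finrank_self]; ring)
    have hf : ((ellipticForm g m).comp e.toLinearMap).Equivalent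
      (ellipticForm g m) := ⟨⟨e, fun _ => rfl⟩⟩
    refine ⟨quadricOf _ _, Or.inr (Or.inl ⟨m, g, _, hg, hf, rfl⟩), key _ ?_⟩
    rw [h, ncard_vectorsOf_quadricOf, ncard_zeros_of_equivalent_ellipticForm hg hf]
    ring

/-- If the line through `v` in the direction of a non-singular vector `n` contains exactly one zero,
then `v` is orthogonal to `n`. -/
theorem radical_of_existsUnique_zero [CharP K 2] (f : QuadraticForm K V) {n : V} (hn : f n ≠ 0)
    {v : V} (h : ∃! t : K, f (v + t • n) = 0) : QuadraticMap.polar f n v = 0 := by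
  by_contra hne
  obtain ⟨t, ht, huniq⟩ := h
  have ht : f (v + t • n) = 0 := ht
  -- The quadratic f(n) t² + polar f n v · t + f(v) has roots with sum polar f n v / f n, which
  -- gives a second root different from t.
  have := huniq (t + QuadraticMap.polar f n v / f n) (by
    have h2 : (2 : K) = 0 := CharTwo.two_eq_zero
    show f _ = 0
    have hs := div_mul_cancel₀ (QuadraticMap.polar f n v) hn
    rw [map_add_smul_eq, QuadraticMap.polar_comm f v n] at ht ⊢
    linear_combination ht + (t * (QuadraticMap.polar f n v / f n) * f n +
      (QuadraticMap.polar f n v / f n) ^ 2 * f n) * h2 -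
      (QuadraticMap.polar f n v / f n) * hs)
  rw [add_eq_left, div_eq_zero_iff] at this
  exact this.elim hne hn

/-- Some v + t • w is singular; it lies in the radical too, so it vanishes by nondegeneracy. -/
theorem exists_smul_eq_of_radical [Finite K] [CharP K 2] {f : QuadraticForm K V} {k : ℕ}
    (hf : f.Equivalent (parabolicForm K k)) {v w : V} (hw : f w ≠ 0)
    (hv : ∀ u, QuadraticMap.polar f v u = 0) (hwr : ∀ u, QuadraticMap.polar f w u = 0) :
    ∃ t : K, v = t • w := by
  obtain ⟨t, ht, -⟩ := existsUnique_zero_of_radical f hw hwr v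
  refine ⟨-t, ?_⟩
  have := nondegenerate_of_equivalent_parabolicForm hf (v + t • w) (fun u => by
    rw [QuadraticMap.polar_add_left, QuadraticMap.polar_smul_left, hv, hwr, smul_zero, add_zero]) ht
  rw [neg_smul]
  exact eq_neg_of_add_eq_zero_left this

theorem isNucleus_quadricOf_iff [Finite K] [CharP K 2] {W : Submodule K V} {f : QuadraticForm K W}
    {n : V} (hn : n ≠ 0) :
    IsNucleus W (quadricOf W f) (Projectivization.mk K n hn) ↔
      ∃ h : n ∈ W, f ⟨n, h⟩ ≠ 0 ∧ ∀ w, QuadraticMap.polar f ⟨n, h⟩ w = 0 := by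
  have hmem : ∀ (v : W) (h : n ∈ W) (t : K), (v : V) + t • n ∈ vectorsOf (quadricOf W f) ↔
      f (v + t • ⟨n, h⟩) = 0 := fun v h t =>
    mem_vectorsOf_quadricOf.trans ⟨fun ⟨_, h⟩ => h, fun h' => ⟨(v + t • ⟨n, h⟩ : W).2, h'⟩⟩
  rw [isNucleus_mk_iff]
  constructor
  · rintro ⟨hnW, hnQ, h⟩
    have hfn : f ⟨n, hnW⟩ ≠ 0 := fun h0 => hnQ (mem_vectorsOf_quadricOf.2 ⟨hnW, h0⟩)
    refine ⟨hnW, hfn, fun w => ?_⟩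
    -- Multiples of n are not covered by the lines through the nucleus, but the polar form is
    -- alternating in characteristic two.
    by_cases hw : (w : V) ∈ Submodule.span K {n}
    · obtain ⟨t, ht⟩ := Submodule.mem_span_singleton.1 hw
      obtain rfl : t • (⟨n, hnW⟩ : W) = w := Subtype.ext ht
      rw [QuadraticMap.polar_smul_right, QuadraticMap.polar_self, two_smul,
        CharTwo.add_self_eq_zero, smul_zero]
    · have := h w w.2 hw
      simp only [hmem w hnW] at this
      exact radical_of_existsUnique_zero f hfn this
  · rintro ⟨hnW, hfn, hpol⟩
    refine ⟨hnW, fun h => hfn (mem_vectorsOf_quadricOf.1 h).2, fun v hv _ => ?_⟩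
    have := existsUnique_zero_of_radical f hfn hpol ⟨v, hv⟩
    simpa only [← hmem] using this

theorem isNucleus_unique [Finite K] [CharP K 2] {W : Submodule K V} {C : Set (ℙ K V)}
    (hC : IsParabolicQuadric W C) {N N' : ℙ K V} (hN : IsNucleus W C N) (hN' : IsNucleus W C N') :
    N = N' := by
  obtain ⟨k, f, hf, rfl⟩ := hC
  induction N with
  | h n hn =>
    induction N' with
    | h n' hn' =>
      obtain ⟨h, -, hpol⟩ := (isNucleus_quadricOf_iff hn).1 hN
      obtain ⟨h', hfn', hpol'⟩ := (isNucleus_quadricOf_iff hn').1 hN'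
      obtain ⟨t, ht⟩ := exists_smul_eq_of_radical hf hfn' hpol hpol'
      exact (Projectivization.mk_eq_mk_iff' K _ _ _ _).2 ⟨t, (congrArg Subtype.val ht).symm⟩

end Hyperplanes

/-! ### The pivoted set: hyperplane counts and absence of a nucleus. -/

section Pivoting

variable {K : Type*} [Field K] {V : Type*} [AddCommGroup V] [Module K V]

theorem vectorsOf_pivot {Q C' : Set (ℙ K V)} {π : Submodule K V} {P : ℙ K V} :
    vectorsOf (pivot Q π P C') = (vectorsOf Q \ π) ∪ vectorsOf (cone P C') := by
  ext v
  by_cases hv : v = 0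
  · subst hv; simp [zero_mem_vectorsOf]
  · rw [pivot, mem_vectorsOf_union, mem_vectorsOf_diff hv, vectorsOf_inter, vectorsOf_pointsOf]
    simp only [Set.mem_inter_iff, Set.mem_union, Set.mem_sdiff]
    tauto

theorem vectorsOf_cone_subset {μ π : Submodule K V} (hμ : μ ≤ π) {p : V} (hp : p ≠ 0) (hpπ : p ∈ π)
    {C : Set (ℙ K V)} (hC : vectorsOf C ⊆ μ) :
    vectorsOf (cone (Projectivization.mk K p hp) C) ⊆ π := by
  intro v hv
  obtain ⟨t, u, hu, rfl⟩ := (mem_vectorsOf_cone hp).1 hv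
  exact π.add_mem (hμ (hC hu)) (π.smul_mem t hpπ)

/-- The vertex of the cone cut out by a singular hyperplane is a singular point whose polar
hyperplane is that hyperplane. -/
theorem MeetsInCone.polar_eq_zero [CharP K 2] [FiniteDimensional K V] {Q : Set (ℙ K V)}
    {π μ : Submodule K V} {p : V} {hp : p ≠ 0}
    (h : MeetsInCone Q π μ (Projectivization.mk K p hp)) {F : QuadraticForm K V}
    (hF : vectorsOf Q = {v | F v = 0}) :
    F p = 0 ∧ ∀ v ∈ π, QuadraticMap.polar F v p = 0 := by
  obtain ⟨-, hμ, hpπ, hpμ, -, hcone⟩ := h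
  rw [mk_mem_pointsOf] at hpπ hpμ
  have hmem : ∀ v ∈ π, F v = 0 ↔ ∃ t : K, ∃ u, (F u = 0 ∧ u ∈ μ) ∧ v = u + t • p := by
    intro v hv
    have := congrArg (v ∈ ·) (congrArg vectorsOf hcone)
    simp only [mem_vectorsOf_cone hp, vectorsOf_inter, vectorsOf_pointsOf, hF,
      Set.mem_inter_iff, SetLike.mem_coe, hv, and_true, Set.mem_ofPred_eq] at this
    exact iff_of_eq this
  have hFp : F p = 0 := (hmem p hpπ).2 ⟨1, 0, ⟨map_zero F, μ.zero_mem⟩, by simp⟩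
  have hval : ∀ u t, F (u + t • p) = F u + t * QuadraticMap.polar F u p := by
    intro u t
    rw [map_add_smul_eq, hFp, mul_zero, add_zero]
  -- The sum of μ and the line of p is direct, so the base vector supplied by the cone must be u
  -- itself.
  have hproj : ∀ u ∈ μ, ∀ t : K, F (u + t • p) = 0 → F u = 0 := by
    intro u hu t h0
    obtain ⟨s, u', ⟨hu', hu'μ⟩, heq⟩ :=
      (hmem _ (π.add_mem (hμ.1 hu) (π.smul_mem t hpπ))).1 h0
    have hst : (s - t) • p ∈ μ := by
      have : (s - t) • p = u - u' := by
        rw [sub_smul, sub_eq_sub_iff_add_eq_add, add_comm, ← heq, add_comm]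
      rw [this]
      exact μ.sub_mem hu hu'μ
    have h1 : s = t := by
      by_contra hne
      exact hpμ ((μ.smul_mem_iff (sub_ne_zero.2 hne)).1 hst)
    rw [h1] at heq
    rw [add_right_cancel heq, hu']
  -- Were the polar value nonzero, u + t • p would be singular for some t, so u is singular; the
  -- cone then contains u + p, where F takes exactly that value.
  have hμpol : ∀ u ∈ μ, QuadraticMap.polar F u p = 0 := by
    intro u hu
    by_contra hne
    have hFu : F u = 0 := hproj u hu (-F u / QuadraticMap.polar F u p) (by
      rw [hval]; field_simp; ring)
    have h1 := (hmem (u + (1 : K) • p) (π.add_mem (hμ.1 hu) (π.smul_mem 1 hpπ))).2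
      ⟨1, u, ⟨hFu, hu⟩, rfl⟩
    rw [hval, hFu, zero_add, one_mul] at h1
    exact hne h1
  refine ⟨hFp, fun v hv => ?_⟩
  obtain ⟨u, hu, t, rfl⟩ := exists_eq_add_smul_of_isHyperplaneOf hμ hpπ hpμ hv
  rw [QuadraticMap.polar_add_left, QuadraticMap.polar_smul_left, hμpol u hu,
    QuadraticMap.polar_self, hFp, smul_zero, smul_zero, zero_add]

/-- Otherwise p would be orthogonal to π and to v, hence to everything, and a singular vector of the
radical is zero. -/
theorem polar_ne_zero_of_notMem [FiniteDimensional K V] [CharP K 2] {F : QuadraticForm K V} {k : ℕ}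
    (hF : F.Equivalent (parabolicForm K k)) {π : Submodule K V} (hπ : IsHyperplaneOf π ⊤) {p : V}
    (hp : p ≠ 0) (hFp : F p = 0) (hpol : ∀ v ∈ π, QuadraticMap.polar F v p = 0) {v : V}
    (hv : v ∉ π) : QuadraticMap.polar F v p ≠ 0 := by
  intro h0
  refine hp (nondegenerate_of_equivalent_parabolicForm hF p (fun w => ?_) hFp)
  obtain ⟨u, hu, t, rfl⟩ := exists_eq_add_smul_of_isHyperplaneOf hπ Submodule.mem_top hv
    (Submodule.mem_top (x := w))
  rw [QuadraticMap.polar_comm, QuadraticMap.polar_add_left, QuadraticMap.polar_smul_left,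
    hpol u hu, h0, smul_zero, add_zero]

theorem existsUnique_zero_of_polar_ne_zero {F : QuadraticForm K V} {p : V} (hFp : F p = 0) {v : V}
    (h : QuadraticMap.polar F v p ≠ 0) : ∃! t : K, F (v + t • p) = 0 := by
  have hval : ∀ t, F (v + t • p) = F v + t * QuadraticMap.polar F v p := by
    intro t
    rw [map_add_smul_eq, hFp, mul_zero, add_zero]
  refine ⟨-F v / QuadraticMap.polar F v p, (hval _).trans (by field_simp; ring), fun t ht => ?_⟩
  have ht : F (v + t • p) = 0 := ht
  rw [hval] at ht
  field_simp
  linear_combination ht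

/-- A hyperplane through the vertex `p` other than `π = p^⊥` contains a constant number of zeros
outside `π`. -/
theorem ncard_zeros_inter_ker_diff [Finite K] [FiniteDimensional K V] {F : QuadraticForm K V}
    {π : Submodule K V} {p : V} (hFp : F p = 0) (hpπ : p ∈ π)
    (hne : ∀ v ∉ π, QuadraticMap.polar F v p ≠ 0)
    {φ : Module.Dual K V} (hp : φ p = 0) :
    ((LinearMap.ker φ : Set V) \ π).ncard =
      Nat.card K * (({v | F v = 0} \ π) ∩ LinearMap.ker φ).ncard := by
  have : Finite V := Module.finite_of_finite K
  have hπ : ∀ v (t : K), v + t • p ∈ π ↔ v ∈ π := fun v t =>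
    π.add_mem_iff_left (π.smul_mem t hpπ)
  refine ncard_eq_mul_of_existsUnique_translate p (fun v hv => ⟨hv.2, hv.1.2⟩) ?_ ?_
  · rintro v ⟨hv, hvπ⟩ t
    refine ⟨(LinearMap.ker φ).add_mem hv ((LinearMap.ker φ).smul_mem t hp), fun h => hvπ ?_⟩
    exact (hπ v t).1 h
  · rintro v ⟨hv, hvπ⟩
    have := existsUnique_zero_of_polar_ne_zero hFp (hne v hvπ)
    have hv : φ v = 0 := hv
    have hvπ : v ∉ π := hvπ
    simpa [hπ, hvπ, hv, hp] using this

section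

variable [Finite K] [CharP K 2] [FiniteDimensional K V] {Q C' : Set (ℙ K V)} {π μ : Submodule K V}
  {p : V} {hp : p ≠ 0}

omit [Finite K] [CharP K 2] [FiniteDimensional K V] in
theorem exists_form_of_isParabolicQuadric {W : Submodule K V} {C : Set (ℙ K V)}
    (hC : IsParabolicQuadric W C) {k : ℕ} (hW : Module.finrank K W = 2 * k + 1) :
    ∃ f : QuadraticForm K W, f.Equivalent (parabolicForm K k) ∧ C = quadricOf W f := by
  obtain ⟨k', f, hf, rfl⟩ := hC
  obtain rfl : k' = k := by
    have := finrank_of_equivalent_parabolicForm hf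
    omega
  exact ⟨f, hf, rfl⟩

theorem ncard_vectorsOf_of_isParabolicQuadric {W : Submodule K V} {C : Set (ℙ K V)}
    (hC : IsParabolicQuadric W C) :
    Nat.card K * (vectorsOf C).ncard = Nat.card K ^ Module.finrank K W := by
  obtain ⟨k, f, hf, rfl⟩ := hC
  rw [ncard_vectorsOf_quadricOf, ncard_zeros_of_equivalent_parabolicForm hf,
    finrank_of_equivalent_parabolicForm hf, pow_succ']

omit [Finite K] [CharP K 2] [FiniteDimensional K V] in
theorem vectorsOf_subset_of_isParabolicQuadric {W : Submodule K V} {C : Set (ℙ K V)}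
    (hC : IsParabolicQuadric W C) : vectorsOf C ⊆ W := by
  obtain ⟨k, f, hf, rfl⟩ := hC
  exact vectorsOf_quadricOf_subset W f

theorem ncard_vectorsOf_eq_of_isParabolicQuadric {W : Submodule K V} {C C' : Set (ℙ K V)}
    (hC : IsParabolicQuadric W C) (hC' : IsParabolicQuadric W C') :
    (vectorsOf C).ncard = (vectorsOf C').ncard :=
  Nat.eq_of_mul_eq_mul_left (Nat.card_pos (α := K))
    ((ncard_vectorsOf_of_isParabolicQuadric hC).trans
      (ncard_vectorsOf_of_isParabolicQuadric hC').symm)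

omit [CharP K 2] in
/-- Pivoting does not change the number of vectors in a set which meets both cones equally. -/
theorem ncard_vectorsOf_pivot_inter (h : MeetsInCone Q π μ (Projectivization.mk K p hp))
    (hC' : IsParabolicQuadric μ C') {A : Set V}
    (hA : (vectorsOf (cone (Projectivization.mk K p hp) (Q ∩ pointsOf μ)) ∩ A).ncard =
      (vectorsOf (cone (Projectivization.mk K p hp) C') ∩ A).ncard) :
    (vectorsOf (pivot Q π (Projectivization.mk K p hp) C') ∩ A).ncard =
      (vectorsOf Q ∩ A).ncard := by
  have : Finite V := Module.finite_of_finite K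
  obtain ⟨-, hμ, hpπ, hpμ, hC, hcone⟩ := h
  rw [mk_mem_pointsOf] at hpπ hpμ
  have hsub := vectorsOf_cone_subset hμ.1 hp hpπ (vectorsOf_subset_of_isParabolicQuadric hC')
  have hQ : vectorsOf Q =
      (vectorsOf Q \ π) ∪ vectorsOf (cone (Projectivization.mk K p hp) (Q ∩ pointsOf μ)) := by
    rw [← hcone, vectorsOf_inter, vectorsOf_pointsOf, Set.sdiff_union_inter]
  have hsub' := vectorsOf_cone_subset hμ.1 hp hpπ (vectorsOf_subset_of_isParabolicQuadric hC)
  have hdisj : ∀ {B : Set V}, B ⊆ π → Disjoint ((vectorsOf Q \ π) ∩ A) (B ∩ A) := fun hB =>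
    Set.disjoint_left.2 fun _ hv hv' => hv.1.2 (hB hv'.1)
  rw [vectorsOf_pivot]
  conv_rhs => rw [hQ]
  rw [Set.union_inter_distrib_right, Set.union_inter_distrib_right,
    Set.ncard_union_eq (hdisj hsub), Set.ncard_union_eq (hdisj hsub'), hA]

theorem ncard_pivot (h : MeetsInCone Q π μ (Projectivization.mk K p hp))
    (hC' : IsParabolicQuadric μ C') :
    (pivot Q π (Projectivization.mk K p hp) C').ncard = Q.ncard := by
  have : Finite V := Module.finite_of_finite K
  apply ncard_eq_of_ncard_vectorsOf_eq
  have hpμ : p ∉ μ := fun h' => h.2.2.2.1 (mk_mem_pointsOf.2 h')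
  have hC := h.2.2.2.2.1
  simpa using ncard_vectorsOf_pivot_inter h hC' (A := Set.univ) (by
    rw [Set.inter_univ, Set.inter_univ,
      ncard_vectorsOf_cone hp hpμ (vectorsOf_subset_of_isParabolicQuadric hC),
      ncard_vectorsOf_cone hp hpμ (vectorsOf_subset_of_isParabolicQuadric hC'),
      ncard_vectorsOf_eq_of_isParabolicQuadric hC hC'])

theorem isParabolicQuasiQuadric_pivot {m : ℕ} (hV : Module.finrank K V = 2 * (m + 1) + 1)
    (hQ : IsParabolicQuadric ⊤ Q) (h : MeetsInCone Q π μ (Projectivization.mk K p hp))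
    (hC' : IsParabolicQuadric μ C') :
    IsParabolicQuasiQuadric (pivot Q π (Projectivization.mk K p hp) C') := by
  have : Finite V := Module.finite_of_finite K
  obtain ⟨k, F, hF, hQF⟩ := exists_quadraticForm_of_isParabolicQuadric_top hQ
  obtain ⟨hFp, hpol⟩ := h.polar_eq_zero hQF
  obtain ⟨hπ, hμ, hpπ, hpμ, hC, hcone⟩ := id h
  rw [mk_mem_pointsOf] at hpπ hpμ
  obtain rfl : k = m + 1 := by
    have := finrank_of_equivalent_parabolicForm hF
    omega
  have hπrank : Module.finrank K π = 2 * (m + 1) := by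
    have := hπ.2
    rw [finrank_top] at this
    omega
  have hμrank : Module.finrank K μ = 2 * m + 1 := by
    have := hμ.2
    omega
  have hne := fun v => polar_ne_zero_of_notMem hF hπ hp hFp hpol (v := v)
  have hCμ := vectorsOf_subset_of_isParabolicQuadric hC
  have hCμ' := vectorsOf_subset_of_isParabolicQuadric hC'
  refine isParabolicQuasiQuadric_of_ncard_vectorsOf hV fun φ hφ => ?_
  have hkerrank := Module.Dual.finrank_ker_add_one_of_ne_zero hφ
  by_cases hφp : φ p = 0
  · by_cases hφπ : π ≤ LinearMap.ker φ
    · have hπeq : π = LinearMap.ker φ := Submodule.eq_of_le_of_finrank_eq hφπ (by omega)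
      refine ⟨0, Or.inl rfl, ?_⟩
      have hset : vectorsOf (pivot Q π (Projectivization.mk K p hp) C') ∩ LinearMap.ker φ =
          vectorsOf (cone (Projectivization.mk K p hp) C') := by
        rw [vectorsOf_pivot, ← hπeq, Set.union_inter_distrib_right, Set.sdiff_inter_self,
          Set.empty_union, Set.inter_eq_left]
        exact vectorsOf_cone_subset hμ.1 hp hpπ hCμ'
      have := ncard_vectorsOf_of_isParabolicQuadric hC'
      rw [hμrank] at this
      rw [hset, ncard_vectorsOf_cone hp hpμ hCμ', this]
      push_cast; ring
    · have hφμ : ¬ μ ≤ LinearMap.ker φ := by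
        intro hle
        refine hφπ ?_
        rw [← sup_span_eq_of_isHyperplaneOf hμ hpπ hpμ]
        exact sup_le hle ((Submodule.span_singleton_le_iff_mem _ _).2 hφp)
      obtain ⟨f', hf', rfl⟩ := exists_form_of_isParabolicQuadric hC' hμrank
      obtain ⟨ε, hε, hcount⟩ := exists_ncard_vectorsOf_quadricOf_inter_ker hf' hφμ
      refine ⟨ε, hε, ?_⟩
      have hsub := vectorsOf_cone_subset hμ.1 hp hpπ hCμ'
      have hdisj : Disjoint (({v | F v = 0} \ π) ∩ (LinearMap.ker φ : Set V))
          (vectorsOf (cone (Projectivization.mk K p hp) (quadricOf μ f')) ∩ LinearMap.ker φ) :=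
        Set.disjoint_left.2 fun _ hv hv' => hv.1.2 (hsub hv'.1)
      rw [vectorsOf_pivot, hQF, Set.union_inter_distrib_right, Set.ncard_union_eq hdisj,
        ncard_vectorsOf_cone_inter_of_mem hp hpμ hCμ' hφp]
      have h1 := ncard_zeros_inter_ker_diff hFp hpπ hne hφp
      have h2 := ncard_inter_ker hφπ
      have h4 := Set.ncard_inter_add_ncard_sdiff_eq_ncard (LinearMap.ker φ : Set V) (π : Set V)
      rw [ncard_coe_submodule, h1, Set.inter_comm,
        show Module.finrank K (LinearMap.ker φ) = 2 * (m + 1) by omega] at h4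
      rw [hπrank] at h2
      have hq : (Nat.card K : ℤ) ≠ 0 := by exact_mod_cast Nat.card_pos.ne'
      zify at h2 h4
      push_cast
      have h2' : (((π : Set V) ∩ LinearMap.ker φ).ncard : ℤ) = Nat.card K ^ (2 * m + 1) :=
        mul_left_cancel₀ hq (h2.trans (by ring))
      -- Outside π the contribution, times q, is q^(2m+2) - q^(2m+1). The cone adds q (q^(2m) + ε
      -- q^m (q - 1)), and the powers q^(2m+1) cancel.
      linear_combination h4 - h2' + (Nat.card K : ℤ) * hcount
  -- Here P is off the hyperplane: both cones meet it in as many vectors as their bases have, so the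
  -- count is that of Q.
  · obtain ⟨ε, hε, hcount⟩ := exists_ncard_zeros_inter hF (LinearMap.ker φ) hkerrank
    refine ⟨ε, hε, ?_⟩
    rw [← hcount, ncard_vectorsOf_pivot_inter h hC', hQF, Set.inter_comm]
    · rfl
    · rw [ncard_vectorsOf_cone_inter_of_notMem hp hpμ hCμ hφp,
        ncard_vectorsOf_cone_inter_of_notMem hp hpμ hCμ' hφp,
        ncard_vectorsOf_eq_of_isParabolicQuadric hC hC']

omit [FiniteDimensional K V] in
theorem isNucleus_top_of_radical {F : QuadraticForm K V} (hQF : vectorsOf Q = {v | F v = 0})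
    {x : V} (hx : x ≠ 0) (hFx : F x ≠ 0) (hpol : ∀ w, QuadraticMap.polar F x w = 0) :
    IsNucleus ⊤ Q (Projectivization.mk K x hx) := by
  rw [isNucleus_mk_iff, hQF]
  exact ⟨trivial, hFx, fun v _ _ => existsUnique_zero_of_radical F hFx hpol v⟩

omit [Finite K] in
/-- A singular vector none of whose lines outside the hyperplane `p^⊥` is a tangent line is
proportional to `p`. -/
theorem exists_eq_smul_of_polar_ne_zero {F : QuadraticForm K V} {k : ℕ}
    (hF : F.Equivalent (parabolicForm K k)) (hπ : IsHyperplaneOf π ⊤)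
    (hFp : F p = 0) (hpol : ∀ v ∈ π, QuadraticMap.polar F v p = 0)
    (hpolne : ∀ v ∉ π, QuadraticMap.polar F v p ≠ 0) {v₀ : V} (hv₀ : v₀ ∉ π) {x : V}
    (hxπ : x ∈ π) (hFx : F x = 0) (hx : ∀ v ∉ π, QuadraticMap.polar F v x ≠ 0) :
    ∃ t : K, x = t • p := by
  have hxpol : ∀ u ∈ π, QuadraticMap.polar F u x = 0 := by
    intro u hu
    by_contra hne
    -- This multiple of u is chosen to make v₀ orthogonal to x without moving it into π.
    refine hx (v₀ + (-QuadraticMap.polar F v₀ x / QuadraticMap.polar F u x) • u)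
      (fun h => hv₀ ((π.add_mem_iff_left (π.smul_mem _ hu)).1 h)) ?_
    rw [QuadraticMap.polar_add_left, QuadraticMap.polar_smul_left, smul_eq_mul,
      div_mul_cancel₀ _ hne, add_neg_cancel]
  have hpv₀ := hpolne v₀ hv₀
  -- With this t the vector x + t • p is orthogonal to v₀ and to π, hence radical; it is also
  -- singular, so it is zero.
  set t := -QuadraticMap.polar F v₀ x / QuadraticMap.polar F v₀ p with ht
  refine ⟨-t, ?_⟩
  rw [neg_smul]
  refine eq_neg_of_add_eq_zero_left (nondegenerate_of_equivalent_parabolicForm hF _ (fun w => ?_) ?_)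
  · obtain ⟨u, hu, s, rfl⟩ := exists_eq_add_smul_of_isHyperplaneOf hπ Submodule.mem_top hv₀
      (Submodule.mem_top (x := w))
    rw [QuadraticMap.polar_comm, QuadraticMap.polar_add_left, QuadraticMap.polar_smul_left,
      QuadraticMap.polar_add_right, QuadraticMap.polar_smul_right, QuadraticMap.polar_add_right,
      QuadraticMap.polar_smul_right, hxpol u hu, hpol u hu, smul_eq_mul t, smul_eq_mul t, ht,
      div_mul_cancel₀ _ hpv₀]
    simp
  · rw [map_add_smul_eq, hFx, hFp, hpol x hxπ]
    simp

theorem not_isNucleus_pivot {N N' : ℙ K V}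
    (hQ : IsParabolicQuadric ⊤ Q) (hN : IsNucleus ⊤ Q N)
    (h : MeetsInCone Q π μ (Projectivization.mk K p hp)) (hNμ : N ∈ pointsOf μ)
    (hC' : IsParabolicQuadric μ C') (hN' : IsNucleus μ C' N') (hne : N' ≠ N) (M : ℙ K V) :
    ¬ IsNucleus ⊤ (pivot Q π (Projectivization.mk K p hp) C') M := by
  obtain ⟨k, F, hF, hQF⟩ := exists_quadraticForm_of_isParabolicQuadric_top hQ
  obtain ⟨hFp, hpol⟩ := h.polar_eq_zero hQF
  obtain ⟨hπ, hμ, hpπ, hpμ, hC, hcone⟩ := id h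
  rw [mk_mem_pointsOf] at hpπ hpμ
  have hpolne := fun v => polar_ne_zero_of_notMem hF hπ hp hFp hpol (v := v)
  have hCμ' := vectorsOf_subset_of_isParabolicQuadric hC'
  have hsub := vectorsOf_cone_subset hμ.1 hp hpπ hCμ'
  have hpcone : ∀ t : K, t • p ∈ vectorsOf (cone (Projectivization.mk K p hp) C') := fun t =>
    (mem_vectorsOf_cone hp).2 ⟨t, 0, zero_mem_vectorsOf C', by simp⟩
  have hout : ∀ v ∉ π, v ∈ vectorsOf (pivot Q π (Projectivization.mk K p hp) C') ↔ F v = 0 := by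
    intro v hv
    rw [vectorsOf_pivot, hQF]
    have : v ∉ vectorsOf (cone (Projectivization.mk K p hp) C') := fun h => hv (hsub h)
    simp [hv, this]
  induction M with
  | h x hx =>
  intro hM
  obtain ⟨-, hxS, huniq⟩ := (isNucleus_mk_iff hx).1 hM
  by_cases hxπ : x ∈ π
  · have hxline : ∀ v ∉ π, ∃! t : K, F (v + t • x) = 0 := by
      intro v hv
      have h1 := huniq v trivial (fun h => hv (by
        obtain ⟨t, rfl⟩ := Submodule.mem_span_singleton.1 h
        exact π.smul_mem t hxπ))
      have h2 : ∀ t : K, v + t • x ∉ π := fun t h =>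
        hv ((π.add_mem_iff_left (π.smul_mem t hxπ)).1 h)
      simpa only [hout _ (h2 _)] using h1
    obtain ⟨v₀, -, hv₀⟩ : ∃ v₀ ∈ (⊤ : Submodule K V), v₀ ∉ π :=
      SetLike.exists_of_lt (lt_of_le_of_ne hπ.1 fun h0 => by
        have := hπ.2
        rw [h0] at this
        omega)
    -- If x is singular and orthogonal to some v outside π, then F is constant on v + K x, which
    -- cannot have exactly one zero. So x is a multiple of p, and P is in the pivoted set.
    by_cases hFx : F x = 0
    · obtain ⟨t, rfl⟩ := exists_eq_smul_of_polar_ne_zero hF hπ hFp hpol hpolne hv₀ hxπ hFx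
        fun v hv h0 => by
          have hval : ∀ t : K, F (v + t • x) = F v := fun t => by
            rw [map_add_smul_eq, h0, hFx, mul_zero, mul_zero, add_zero, add_zero]
          obtain ⟨t, ht, hu⟩ := hxline v hv
          have h1 := hu (t + 1) ((hval _).trans ((hval t).symm.trans ht))
          exact one_ne_zero (add_eq_left.1 h1)
      exact hxS (by rw [vectorsOf_pivot]; exact Or.inr (hpcone t))
    · have hout' : ∀ v ∉ π, QuadraticMap.polar F x v = 0 := fun v hv =>
        radical_of_existsUnique_zero F hFx (hxline v hv)
      have hrad : ∀ v, QuadraticMap.polar F x v = 0 := by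
        intro v
        by_cases hv : v ∈ π
        -- A vector of π is the difference of v + v₀ and v₀, both outside π.
        · have h1 := hout' (v + v₀) fun h => hv₀ ((π.add_mem_iff_right hv).1 h)
          rwa [QuadraticMap.polar_add_right, hout' v₀ hv₀, add_zero] at h1
        · exact hout' v hv
      have hxN := isNucleus_unique hQ (isNucleus_top_of_radical hQF hx hFx hrad) hN
      have hxμ : x ∈ μ := by rwa [← hxN, mk_mem_pointsOf] at hNμ
      have hmem : ∀ w ∈ μ, w ∈ vectorsOf (pivot Q π (Projectivization.mk K p hp) C') ↔
          w ∈ vectorsOf C' := by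
        intro w hw
        rw [vectorsOf_pivot, Set.mem_union, or_iff_right fun h => h.2 (hμ.1 hw),
          mem_vectorsOf_cone hp]
        refine ⟨?_, fun h => ⟨0, w, h, by simp⟩⟩
        rintro ⟨t, u, hu, rfl⟩
        have htp : t • p ∈ μ := (μ.add_mem_iff_right (hCμ' hu)).1 hw
        have ht : t = 0 := by
          by_contra ht
          exact hpμ ((μ.smul_mem_iff ht).1 htp)
        simpa [ht] using hu
      refine hne ((isNucleus_unique hC' hN' ?_).trans hxN)
      refine (isNucleus_mk_iff hx).2 ⟨hxμ, fun h => hxS ((hmem x hxμ).2 h), fun v hv hvx => ?_⟩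
      have h1 := huniq v trivial hvx
      have h2 : ∀ t : K, v + t • x ∈ μ := fun t => μ.add_mem hv (μ.smul_mem t hxμ)
      simpa only [hmem _ (h2 _)] using h1
  · have hxp : QuadraticMap.polar F x p ≠ 0 := hpolne x hxπ
    obtain ⟨t, ht, -⟩ := existsUnique_zero_of_polar_ne_zero hFp hxp
    have ht : F (x + t • p) = 0 := ht
    have ht0 : t ≠ 0 := by
      rintro rfl
      rw [zero_smul, add_zero] at ht
      exact hxS ((hout x hxπ).2 ht)
    have hmem := (hout (x + t • p) fun h =>
      hxπ ((π.add_mem_iff_left (π.smul_mem t hpπ)).1 h)).2 ht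
    have hpx : p ∉ Submodule.span K {x} := by
      intro h
      obtain ⟨s, hs⟩ := Submodule.mem_span_singleton.1 h
      have hs0 : s ≠ 0 := by
        rintro rfl
        rw [zero_smul] at hs
        exact hp hs.symm
      exact hxπ ((π.smul_mem_iff hs0).1 (hs ▸ hpπ))
    -- On the line p + s • x, the parameter s = 0 gives the vertex and s = t⁻¹ the singular point x
    -- + t • p up to scaling: two points of the set.
    have h0 := (huniq p trivial hpx).unique (y₁ := t⁻¹) (y₂ := 0) (by
      have := smul_mem_vectorsOf hmem t⁻¹
      rwa [smul_add, smul_smul, inv_mul_cancel₀ ht0, one_smul, add_comm] at this) (by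
      rw [vectorsOf_pivot]
      exact Or.inr (by simpa using hpcone 1))
    exact inv_ne_zero ht0 h0

end

end Pivoting

/-! ### Existence of quadrics, singular hyperplanes and displaced nuclei. -/

section Existence

variable {K : Type*} [Field K] {V : Type*} [AddCommGroup V] [Module K V]

theorem exists_linearEquiv_apply_eq {w w' : V} (hw : w ≠ 0) (hw' : w' ≠ 0) :
    ∃ g : V ≃ₗ[K] V, g w = w' := by
  obtain ⟨g, hg⟩ := Submodule.exists_linearEquiv_restrict_eq
    ((LinearEquiv.toSpanNonzeroSingleton K V w hw).symm ≪≫ₗ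
      LinearEquiv.toSpanNonzeroSingleton K V w' hw')
  refine ⟨g, (hg ⟨w, Submodule.mem_span_singleton_self w⟩).symm.trans ?_⟩
  have h1 : (LinearEquiv.toSpanNonzeroSingleton K V w hw).symm
      ⟨w, Submodule.mem_span_singleton_self w⟩ = 1 := by
    rw [LinearEquiv.symm_apply_eq, LinearEquiv.toSpanNonzeroSingleton_one]
  rw [LinearEquiv.trans_apply, h1, LinearEquiv.toSpanNonzeroSingleton_one]

/-- Every point of a subspace of even projective dimension is the nucleus of a non-singular
parabolic quadric. -/
theorem exists_isParabolicQuadric_isNucleus [Finite K] [CharP K 2] {W : Submodule K V}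
    [FiniteDimensional K W] {k : ℕ} (hW : Module.finrank K W = 2 * k + 1) {n : V} (hn : n ≠ 0)
    (hnW : n ∈ W) :
    ∃ C : Set (ℙ K V), IsParabolicQuadric W C ∧ IsNucleus W C (Projectivization.mk K n hn) := by
  let e₀ : W ≃ₗ[K] K × (Fin k → K × K) :=
    LinearEquiv.ofFinrankEq _ _ (hW.trans (finrank_parabolic_space k).symm)
  -- The coordinates are adjusted so that n becomes (1, 0), the radical vector of the standard form.
  obtain ⟨g, hg⟩ := exists_linearEquiv_apply_eq (K := K) (w := e₀ ⟨n, hnW⟩)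
    (w' := ((1 : K), (0 : Fin k → K × K)))
    (e₀.map_ne_zero_iff.2 fun h => hn (congrArg Subtype.val h)) (by simp)
  let e := e₀ ≪≫ₗ g
  have he : e ⟨n, hnW⟩ = (1, 0) := hg
  have hf : ∀ v, (parabolicForm K k).comp e.toLinearMap v = parabolicForm K k (e v) := fun _ => rfl
  refine ⟨_, ⟨k, (parabolicForm K k).comp e.toLinearMap, ⟨⟨e, fun _ => rfl⟩⟩, rfl⟩,
    (isNucleus_quadricOf_iff hn).2 ⟨hnW, ?_, fun w => ?_⟩⟩
  · rw [hf, he, parabolicForm_apply]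
    simp
  · have := polar_parabolicForm k (1, 0) (e w)
    simp only [QuadraticMap.polar, hf, map_add, he] at this ⊢
    simpa using this

/-- The embedding of the coordinate space of a smaller parabolic form. -/
def parabolicEmbedding (K : Type*) [Field K] (m : ℕ) :
    (K × (Fin m → K × K)) →ₗ[K] K × (Fin (m + 1) → K × K) :=
  LinearMap.prodMap LinearMap.id
    ((Fin.consLinearEquiv K fun _ : Fin (m + 1) => K × K).toLinearMap ∘ₗ LinearMap.inr K _ _)

/-- In standard coordinates take π : y₁ = 0, let P be the x₁-axis and μ : x₁ = y₁ = 0. On π the form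
does not involve x₁, so the section is a cone over the smaller parabolic quadric in μ, and N, the
x₀-axis, lies in μ. -/
theorem exists_meetsInCone [Finite K] [CharP K 2] [FiniteDimensional K V] {m : ℕ}
    (hV : Module.finrank K V = 2 * (m + 1) + 1) {Q : Set (ℙ K V)} (hQ : IsParabolicQuadric ⊤ Q) :
    ∃ (N P : ℙ K V) (π μ : Submodule K V), IsNucleus ⊤ Q N ∧ MeetsInCone Q π μ P ∧
      N ∈ pointsOf μ := by
  obtain ⟨k, F, hF, hQF⟩ := exists_quadraticForm_of_isParabolicQuadric_top hQ
  obtain rfl : k = m + 1 := by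
    have := finrank_of_equivalent_parabolicForm hF
    omega
  obtain ⟨e'⟩ := hF
  obtain ⟨e, he⟩ : ∃ e : V ≃ₗ[K] K × (Fin (m + 1) → K × K),
      ∀ v, F v = parabolicForm K (m + 1) (e v) := ⟨e'.toLinearEquiv, fun v => (e'.map_app v).symm⟩
  let ι : (K × (Fin m → K × K)) →ₗ[K] V := e.symm.toLinearMap ∘ₗ parabolicEmbedding K m
  have heι : ∀ x z, e (ι (x, z)) = (x, Fin.cons 0 z) := fun x z => e.apply_symm_apply _
  have hι : Function.Injective ι := by
    rintro ⟨x, z⟩ ⟨x', z'⟩ h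
    have h := congrArg e h
    rw [heι, heι, Prod.mk.injEq] at h
    rw [h.1, Fin.cons_right_injective _ h.2]
  let ψ : Module.Dual K V := LinearMap.snd K K K ∘ₗ LinearMap.proj (0 : Fin (m + 1)) ∘ₗ
    LinearMap.snd K K (Fin (m + 1) → K × K) ∘ₗ e.toLinearMap
  have hψ : ∀ v, ψ v = ((e v).2 0).2 := fun _ => rfl
  have hψ0 : ψ ≠ 0 := by
    intro h
    have := LinearMap.congr_fun h (e.symm (0, fun _ => (0, 1)))
    rw [hψ, e.apply_symm_apply] at this
    exact one_ne_zero this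
  let p : V := e.symm (0, Fin.cons (1, 0) 0)
  have hep : e p = (0, Fin.cons (1, 0) 0) := e.apply_symm_apply _
  have hadd : ∀ x z (t : K), e (ι (x, z) + t • p) = (x, Fin.cons (t, 0) z) := by
    intro x z t
    rw [map_add, map_smul, heι, hep]
    refine Prod.ext (by simp) (funext fun i => ?_)
    refine Fin.cases ?_ (fun i => ?_) i <;> simp
  have hFadd : ∀ x z (t : K), F (ι (x, z) + t • p) = parabolicForm K m (x, z) := by
    intro x z t
    rw [he, hadd, parabolicForm_apply, parabolicForm_apply, Fin.sum_univ_succ]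
    simp
  have hFι : ∀ y, F (ι y) = parabolicForm K m y := by
    rintro ⟨x, z⟩
    simpa using hFadd x z 0
  have hdecomp : ∀ v, ψ v = 0 → ∃ y, ∃ t : K, v = ι y + t • p := by
    intro v hv
    refine ⟨((e v).1, fun i => (e v).2 i.succ), ((e v).2 0).1, e.injective ?_⟩
    rw [hadd]
    refine Prod.ext rfl (funext fun i => ?_)
    refine Fin.cases ?_ (fun i => ?_) i
    · exact Prod.ext rfl hv
    · rfl
  have hp : p ≠ 0 := by
    intro h
    have := congrArg (fun v => ((e v).2 0).1) h
    simp [hep] at this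
  have hpμ : p ∉ LinearMap.range ι := by
    rintro ⟨⟨x, z⟩, h⟩
    have := congrArg (fun v => ((e v).2 0).1) h
    simp [heι, hep] at this
  have hrange : LinearMap.range ι ≤ LinearMap.ker ψ := by
    rintro _ ⟨⟨x, z⟩, rfl⟩
    rw [LinearMap.mem_ker, hψ, heι]
    rfl
  have hpψ : p ∈ LinearMap.ker ψ := by
    rw [LinearMap.mem_ker, hψ, hep]
    rfl
  have hker := Module.Dual.finrank_ker_add_one_of_ne_zero hψ0
  let n : V := ι (1, 0)
  have hn : n ≠ 0 := (map_ne_zero_iff ι hι).2 (by simp)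
  have hen : e n = (1, 0) := by
    rw [heι]
    exact Prod.ext rfl (funext (Fin.cases rfl fun _ => rfl))
  obtain ⟨f, hf, hvec⟩ := exists_quadricOf_range (parabolicForm K m) ι hι
  have hbase : Q ∩ pointsOf (LinearMap.range ι) = quadricOf (LinearMap.range ι) f := by
    apply vectorsOf_injective
    rw [vectorsOf_inter, vectorsOf_pointsOf, hQF]
    ext v
    constructor
    · rintro ⟨hv, y, rfl⟩
      exact (hvec y).2 ((hFι y).symm.trans hv)
    · intro hv
      obtain ⟨y, rfl⟩ := vectorsOf_quadricOf_subset _ f hv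
      exact ⟨(hFι y).trans ((hvec y).1 hv), y, rfl⟩
  refine ⟨Projectivization.mk K n hn, Projectivization.mk K p hp, LinearMap.ker ψ,
    LinearMap.range ι, isNucleus_top_of_radical hQF hn ?_ fun w => ?_,
    ⟨⟨le_top, by rw [hker, finrank_top]⟩, ⟨hrange, ?_⟩, mk_mem_pointsOf.2 hpψ,
      fun h => hpμ (mk_mem_pointsOf.1 h), ⟨m, f, hf, hbase⟩, ?_⟩,
    mk_mem_pointsOf.2 ⟨_, rfl⟩⟩
  · rw [he, hen, parabolicForm_apply]
    simp
  · have := polar_parabolicForm (m + 1) (1, 0) (e w)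
    simp only [QuadraticMap.polar, he, map_add, hen] at this ⊢
    simpa using this
  · rw [LinearMap.finrank_range_of_inj hι, finrank_parabolic_space]
    omega
  · apply vectorsOf_injective
    ext v
    rw [mem_vectorsOf_cone hp, hbase, vectorsOf_inter, vectorsOf_pointsOf, hQF]
    constructor
    · rintro ⟨hv, hvψ⟩
      obtain ⟨⟨x, z⟩, t, rfl⟩ := hdecomp v hvψ
      exact ⟨t, _, (hvec (x, z)).2 ((hFadd x z t).symm.trans hv), rfl⟩
    · rintro ⟨t, u, hu, rfl⟩
      obtain ⟨⟨x, z⟩, rfl⟩ := vectorsOf_quadricOf_subset _ f hu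
      exact ⟨(hFadd x z t).trans ((hvec (x, z)).1 hu),
        (LinearMap.ker ψ).add_mem (hrange ⟨_, rfl⟩) ((LinearMap.ker ψ).smul_mem t hpψ)⟩

/-- Dimension at least 3 leaves a point of W other than N, and any point of W can serve as a
nucleus. -/
theorem exists_isNucleus_ne [Finite K] [CharP K 2] {W : Submodule K V}
    [FiniteDimensional K W] {k : ℕ} (hW : Module.finrank K W = 2 * (k + 1) + 1) (N : ℙ K V) :
    ∃ (C : Set (ℙ K V)) (N' : ℙ K V), IsParabolicQuadric W C ∧ IsNucleus W C N' ∧ N' ≠ N := by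
  obtain ⟨w, hwW, hwN⟩ : ∃ w ∈ W, w ∉ N.submodule := by
    by_contra! h
    have h1 := N.finrank_submodule
    have : FiniteDimensional K N.submodule := Module.finite_of_finrank_pos (by omega)
    have h2 := Submodule.finrank_mono (show W ≤ N.submodule from h)
    omega
  have hw : w ≠ 0 := fun h0 => hwN (h0 ▸ Submodule.zero_mem _)
  obtain ⟨C, hC, hCN⟩ := exists_isParabolicQuadric_isNucleus hW hw hwW
  refine ⟨C, _, hC, hCN, ?_⟩
  rintro rfl
  exact hwN (Submodule.mem_span_singleton_self w)

theorem exists_isParabolicQuadric_top [FiniteDimensional K V] {k : ℕ}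
    (hV : Module.finrank K V = 2 * k + 1) : ∃ Q : Set (ℙ K V), IsParabolicQuadric ⊤ Q := by
  let e : (⊤ : Submodule K V) ≃ₗ[K] K × (Fin k → K × K) :=
    LinearEquiv.ofFinrankEq _ _ (finrank_top K V ▸ hV.trans (finrank_parabolic_space k).symm)
  exact ⟨_, k, (parabolicForm K k).comp e.toLinearMap, ⟨⟨e, fun _ => rfl⟩⟩, rfl⟩

end Existence

/-! ### The main theorem. -/

theorem mainTheorem8 (K : Type*) [Field K] [Finite K] (hq : Even (Nat.card K))
    (n : ℕ) (hn : 1 < n) :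
    -- a parabolic quasi-quadric with `|Q(2n, q)|` points and without nucleus
    (∃ S : Set (PG (2 * n) K), IsParabolicQuasiQuadric S ∧
      (∃ Q : Set (PG (2 * n) K), IsParabolicQuadric ⊤ Q ∧ S.ncard = Q.ncard) ∧
      ¬ ∃ M : PG (2 * n) K, IsNucleus ⊤ S M) ∧
    -- pivoting with a base quadric whose nucleus differs from `N` gives such a quasi-quadric
    (∀ (Q : Set (PG (2 * n) K)) (N P : PG (2 * n) K)
      (π μ : Submodule K (Fin (2 * n + 1) → K)) (C' : Set (PG (2 * n) K)) (N' : PG (2 * n) K),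
      IsParabolicQuadric ⊤ Q → IsNucleus ⊤ Q N →
      MeetsInCone Q π μ P → N ∈ pointsOf μ →
      IsParabolicQuadric μ C' → IsNucleus μ C' N' → N' ≠ N →
        IsParabolicQuasiQuadric (pivot Q π P C') ∧
        (pivot Q π P C').ncard = Q.ncard ∧
        ¬ ∃ M : PG (2 * n) K, IsNucleus ⊤ (pivot Q π P C') M) ∧
    -- every `Q(2n, q)` has a nucleus and admits such a pivot
    (∀ Q : Set (PG (2 * n) K), IsParabolicQuadric ⊤ Q →
      ∃ (N P : PG (2 * n) K) (π μ : Submodule K (Fin (2 * n + 1) → K))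
        (C' : Set (PG (2 * n) K)) (N' : PG (2 * n) K),
        IsNucleus ⊤ Q N ∧ MeetsInCone Q π μ P ∧ N ∈ pointsOf μ ∧
        IsParabolicQuadric μ C' ∧ IsNucleus μ C' N' ∧ N' ≠ N) := by
  have : CharP K 2 := by
    have := Fintype.ofFinite K
    refine ringChar.of_eq (FiniteField.even_card_iff_char_two.2 ?_)
    rwa [← Nat.card_eq_fintype_card, ← Nat.even_iff]
  -- The condition n > 1 gives μ the vector dimension 2(m + 1) + 1 ≥ 3, room for a second nucleus.
  obtain ⟨m, rfl⟩ : ∃ m, n = m + 1 + 1 := ⟨n - 2, by omega⟩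
  have hV : Module.finrank K (Fin (2 * (m + 1 + 1) + 1) → K) = 2 * (m + 1 + 1) + 1 := by simp
  have hpivot : ∀ (Q : Set (PG (2 * (m + 1 + 1)) K)) (N P : PG (2 * (m + 1 + 1)) K)
      (π μ : Submodule K (Fin (2 * (m + 1 + 1) + 1) → K)) (C' : Set (PG (2 * (m + 1 + 1)) K))
      (N' : PG (2 * (m + 1 + 1)) K),
      IsParabolicQuadric ⊤ Q → IsNucleus ⊤ Q N →
      MeetsInCone Q π μ P → N ∈ pointsOf μ →
      IsParabolicQuadric μ C' → IsNucleus μ C' N' → N' ≠ N →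
        IsParabolicQuasiQuadric (pivot Q π P C') ∧
        (pivot Q π P C').ncard = Q.ncard ∧
        ¬ ∃ M : PG (2 * (m + 1 + 1)) K, IsNucleus ⊤ (pivot Q π P C') M := by
    intro Q N P π μ C' N' hQ hN h hNμ hC' hN' hne
    induction P using Projectivization.ind with
    | h p hp =>
      exact ⟨isParabolicQuasiQuadric_pivot hV hQ h hC', ncard_pivot h hC',
        fun ⟨M, hM⟩ => not_isNucleus_pivot hQ hN h hNμ hC' hN' hne M hM⟩
  have hdata : ∀ Q : Set (PG (2 * (m + 1 + 1)) K), IsParabolicQuadric ⊤ Q →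
      ∃ (N P : PG (2 * (m + 1 + 1)) K) (π μ : Submodule K (Fin (2 * (m + 1 + 1) + 1) → K))
        (C' : Set (PG (2 * (m + 1 + 1)) K)) (N' : PG (2 * (m + 1 + 1)) K),
        IsNucleus ⊤ Q N ∧ MeetsInCone Q π μ P ∧ N ∈ pointsOf μ ∧
        IsParabolicQuadric μ C' ∧ IsNucleus μ C' N' ∧ N' ≠ N := by
    intro Q hQ
    obtain ⟨N, P, π, μ, hN, h, hNμ⟩ := exists_meetsInCone hV hQ
    have hμ : Module.finrank K μ = 2 * (m + 1) + 1 := by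
      have h1 := h.1.2
      have h2 := h.2.1.2
      rw [finrank_top, hV] at h1
      omega
    obtain ⟨C', N', hC', hN', hne⟩ := exists_isNucleus_ne hμ N
    exact ⟨N, P, π, μ, C', N', hN, h, hNμ, hC', hN', hne⟩
  refine ⟨?_, hpivot, hdata⟩
  obtain ⟨Q, hQ⟩ := exists_isParabolicQuadric_top hV
  obtain ⟨N, P, π, μ, C', N', hN, h, hNμ, hC', hN', hne⟩ := hdata Q hQ
  obtain ⟨h1, h2, h3⟩ := hpivot Q N P π μ C' N' hQ hN h hNμ hC' hN' hne
  exact ⟨pivot Q π P C', h1, ⟨Q, hQ, h2⟩, h3⟩
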